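/- Let $\mathbb{K}=\mathbb{R}$ or $\mathbb{C}$, let $M\ge 0$, and let $\beta,\gamma,\delta,k\in\mathbb{K}$ with $\gamma+\delta\neq0$ and $k\neq0$. Let $\alpha$ be a formal constant. For $n\in\mathbb{Z}$ consider dependent variables $a_n$ (row $M$-vectors), $b_n$ (column $M$-vectors) and scalars $u_n$ (invertible), $w_n$, all of them formal power series in $\alpha$ whose coefficients are $\mathbb{K}$-valued functions of time; powers are $u_n^s=\exp(s\log u_n)$ for a chosen differentiable branch of $\log u_n$ (over $\mathbb R$: $u_n$ has positive leading coefficient), and time derivatives are taken coefficientwise. The first flow is \[ \begin{aligned} & a_{n,t_1} - \alpha u_n^\gamma a_{n-1} - \beta u_{n+1}^\delta a_{n+1} - w_n a_n =0,\\ & b_{n,t_1} + \beta u_{n}^\delta b_{n-1} + \alpha u_{n+1}^\gamma b_{n+1} +b_n w_n =0,\\ & u_{n,t_1} + u_n ( a_{n-1} b_{n-1} - a_n b_n ) =0,\\ & w_{n,t_1} + \alpha \delta ( u_n^{\gamma} a_{n-1} b_{n} - u_{n+1}^{\gamma} a_n b_{n+1} ) + \beta \gamma ( u_n^{\delta} a_{n}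 b_{n-1} - u_{n+1}^{\delta} a_{n+1} b_{n} ) =0, \end{aligned} \] and the second flow is \[ \begin{aligned} & a_{n,t_2} + \alpha \gamma u_n^\gamma a_{n-1} - \beta \delta u_{n+1}^\delta a_{n+1} - \gamma \delta a_n b_n a_n =0,\\ & b_{n,t_2} + \beta \delta u_{n}^\delta b_{n-1} - \alpha \gamma u_{n+1}^\gamma b_{n+1} + \gamma \delta b_n a_n b_n =0,\\ & u_{n,t_2} + u_n ( w_{n-1} - w_n ) - ( \gamma - \delta ) u_n ( a_{n-1} b_{n-1} - a_n b_n ) =0,\\ & w_{n,t_2} + \alpha \beta ( \gamma + \delta )( u_{n}^{\gamma + \delta} - u_{n+1}^{\gamma + \delta} ) - \alpha \gamma \delta ( u_n^{\gamma} a_{n-1} b_{n} - u_{n+1}^{\gamma} a_n b_{n+1} ) + \beta \gamma \delta ( u_n^{\delta} a_{n} b_{n-1} - u_{n+1}^{\delta} a_{n+1} b_{n} ) =0. \end{aligned} \] For $\mu,\nu\in\mathbb{K}$ the flow of $\partial_T:=\mu\,\partial_{t_1}+\nu\,\partial_{t_2}$ is the corresponding linear combination. Then there are coefficients $u_n^{(j)}$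 $(j\ge2)$ and $w_n^{(j)}$ $(j\ge3)$, each a polynomial over $\mathbb K$ in finitely many of the components of the $a_{n+i},b_{n+i}$ and of the $u_{n+i}^\gamma$ $(i\in\mathbb{Z})$, the polynomial being the same for all $n$ and independent of $\mu,\nu$, such that the constraints \[ \begin{aligned} \beta u_n^{\gamma+\delta} & = k + ( \gamma + \delta ) u_n^\gamma a_{n-1} b_{n} + \alpha \tfrac{\gamma+ \delta}{k} u_{n-1}^\gamma u_{n}^\gamma u_{n+1}^\gamma a_{n-2} \bigl( I + \tfrac{\gamma + \delta}{k} u_{n}^\gamma b_n a_{n-1} \bigr) b_{n+1} +\alpha^2 u_n^{(2)} +\alpha^3 u_n^{(3)} + \cdots,\\ w_n &= \gamma a_n b_n + \alpha \tfrac{\gamma+\delta}{k} u_{n}^\gamma u_{n+1}^\gamma a_{n-1} b_{n+1} \\ &\quad + \alpha^2 \tfrac{\gamma+\delta}{k^2} u_{n-1}^\gamma u_{n}^\gamma u_{n+1}^\gamma u_{n+2}^\gamma a_{n-2} \bigl( I + \tfrac{\gamma+\delta}{k} u_{n}^\gamma b_n a_{n-1} \bigr)\bigl( I + \tfrac{\gamma+\delta}{k}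 u_{n+1}^\gamma b_{n+1} a_{n} \bigr) b_{n+2} +\alpha^3 w_n^{(3)} +\alpha^4 w_n^{(4)}+\cdots \end{aligned} \] for all $n\in\mathbb{Z}$ ($I$ the $M\times M$ identity matrix) have the following properties. Call a state nondegenerate if, for every $n$, the coefficient of $\alpha^0$ in $\beta u_n^{\gamma+\delta}-\gamma u_n^\gamma a_{n-1}b_n$ is nonzero (that is, the first constraint at $\alpha=0$ has nonzero derivative with respect to $u_n$). 1. The constraints determine $u_n$ and $w_n$ implicitly: given all $a_n,b_n$ at one instant and scalars $\ell_n$ such that $\log u_n=\ell_n$ solves the first constraint at $\alpha=0$ nondegenerately for all $n$, there are unique formal power series $\log u_n$ (with constant term $\ell_n$) and $w_n$ $(n\in\mathbb Z)$ satisfying the constraints. 2. For all $\mu,\nu\in\mathbb{K}$ the flow of $\partial_T$ is tangent to the constraints: at any time at which the constraints and all four equations of the flow hold, the time derivatives of the differences of the two sides of the constraints vanish. 3. For all $\mu,\nu\in\mathbb{K}$ the flow of $\partial_T$ reduces to a system for $a_n,b_n$: if on an open set of times the constraints hold nondegenerately, $\log u_n$ is differentiable, and the equations of the flow for $a_n$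 and $b_n$ hold for all $n$, then its equations for $u_n$ and $w_n$ hold there too. -/

import Mathlib

open scoped PowerSeries

namespace GenToda

noncomputable section

variable {𝕜 : Type*} [RCLike 𝕜] {M : ℕ}

/-- Exponential of a formal power series `f = f₀ + f₁ α + ⋯` in `α`:
`exp f = exp f₀ * ∑ j, (f - f₀)^j / j!`, where `exp f₀` is the exponential of the scalar `f₀`.
The coefficient of `α ^ m` only receives contributions from `j ≤ m`. -/
def sexp (f : 𝕜⟦X⟧) : 𝕜⟦X⟧ :=
  PowerSeries.C (NormedSpace.exp (PowerSeries.constantCoeff f)) *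
    PowerSeries.mk fun m => ∑ j ∈ Finset.range (m + 1),
      ((j.factorial : 𝕜)⁻¹) *
        PowerSeries.coeff m ((f - PowerSeries.C (PowerSeries.constantCoeff f)) ^ j)

/-- A curve of formal power series has the given time derivative, coefficient by coefficient. -/
def HasSeriesDerivAt (f : ℝ → 𝕜⟦X⟧) (f' : 𝕜⟦X⟧) (t : ℝ) : Prop :=
  ∀ m : ℕ, HasDerivAt (fun s => PowerSeries.coeff m (f s)) (PowerSeries.coeff m f') t

/-- Coefficientwise differentiability of a curve of formal power series. -/
def SeriesDifferentiableAt (f : ℝ → 𝕜⟦X⟧) (t : ℝ) : Prop :=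
  ∀ m : ℕ, DifferentiableAt ℝ (fun s => PowerSeries.coeff m (f s)) t

variable (𝕜 M) in
/-- The dependent variables on the lattice at one instant, all of them formal power series in
the constant `α = X`: `a n` is a row vector, `b n` a column vector, `u n` and `w n` are scalars.
The invertible variable `u n` is given through a logarithm (this fixes the branch of its powers). -/
structure State where
  a : ℤ → Fin M → 𝕜⟦X⟧
  b : ℤ → Fin M → 𝕜⟦X⟧
  logU : ℤ → 𝕜⟦X⟧
  w : ℤ → 𝕜⟦X⟧

namespace State

/-- `u n`. -/
def u (x : State 𝕜 M) (n : ℤ) : 𝕜⟦X⟧ := sexp (x.logU n)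

/-- The power `(u n) ^ s`. -/
def upow (x : State 𝕜 M) (s : 𝕜) (n : ℤ) : 𝕜⟦X⟧ := sexp (s • x.logU n)

/-- The scalar `a m * b n` (row times column). -/
def ab (x : State 𝕜 M) (m n : ℤ) : 𝕜⟦X⟧ := x.a m ⬝ᵥ x.b n

end State

/-! The two flows: right-hand sides of the evolution equations, solved for the time derivatives. -/

open PowerSeries in
def firstA (β γ δ : 𝕜) (x : State 𝕜 M) (n : ℤ) : Fin M → 𝕜⟦X⟧ :=
  (X * x.upow γ n) • x.a (n - 1) + (C β * x.upow δ (n + 1)) • x.a (n + 1) + x.w n • x.a n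

open PowerSeries in
def firstB (β γ δ : 𝕜) (x : State 𝕜 M) (n : ℤ) : Fin M → 𝕜⟦X⟧ :=
  -((C β * x.upow δ n) • x.b (n - 1) + (X * x.upow γ (n + 1)) • x.b (n + 1) + x.w n • x.b n)

def firstU (x : State 𝕜 M) (n : ℤ) : 𝕜⟦X⟧ :=
  -(x.u n * (x.ab (n - 1) (n - 1) - x.ab n n))

open PowerSeries in
def firstW (β γ δ : 𝕜) (x : State 𝕜 M) (n : ℤ) : 𝕜⟦X⟧ :=
  -(X * C δ * (x.upow γ n * x.ab (n - 1) n - x.upow γ (n + 1) * x.ab n (n + 1))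
    + C β * C γ * (x.upow δ n * x.ab n (n - 1) - x.upow δ (n + 1) * x.ab (n + 1) n))

open PowerSeries in
def secondA (β γ δ : 𝕜) (x : State 𝕜 M) (n : ℤ) : Fin M → 𝕜⟦X⟧ :=
  -((X * C γ * x.upow γ n) • x.a (n - 1)) + (C β * C δ * x.upow δ (n + 1)) • x.a (n + 1)
    + (C γ * C δ * x.ab n n) • x.a n

open PowerSeries in
def secondB (β γ δ : 𝕜) (x : State 𝕜 M) (n : ℤ) : Fin M → 𝕜⟦X⟧ :=
  -((C β * C δ * x.upow δ n) • x.b (n - 1) - (X * C γ * x.upow γ (n + 1)) • x.b (n + 1)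
    + (C γ * C δ * x.ab n n) • x.b n)

open PowerSeries in
def secondU (γ δ : 𝕜) (x : State 𝕜 M) (n : ℤ) : 𝕜⟦X⟧ :=
  -(x.u n * (x.w (n - 1) - x.w n)
    - C (γ - δ) * x.u n * (x.ab (n - 1) (n - 1) - x.ab n n))

open PowerSeries in
def secondW (β γ δ : 𝕜) (x : State 𝕜 M) (n : ℤ) : 𝕜⟦X⟧ :=
  -(X * C β * C (γ + δ) * (x.upow (γ + δ) n - x.upow (γ + δ) (n + 1))
    - X * C γ * C δ * (x.upow γ n * x.ab (n - 1) n - x.upow γ (n + 1) * x.ab n (n + 1))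
    + C β * C γ * C δ * (x.upow δ n * x.ab n (n - 1) - x.upow δ (n + 1) * x.ab (n + 1) n))

/-! The evolution equations of `∂_T = μ ∂_{t₁} + ν ∂_{t₂}` for a curve of states, at time `t`. -/

/-- The equations for the `a n` and the `b n`. -/
def EvolvesAB (β γ δ μ ν : 𝕜) (x : ℝ → State 𝕜 M) (t : ℝ) : Prop :=
  ∀ (n : ℤ) (i : Fin M),
    HasSeriesDerivAt (fun s => (x s).a n i)
      (μ • firstA β γ δ (x t) n i + ν • secondA β γ δ (x t) n i) t ∧
    HasSeriesDerivAt (fun s => (x s).b n i)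
      (μ • firstB β γ δ (x t) n i + ν • secondB β γ δ (x t) n i) t

/-- The equations for the `u n` and the `w n`. -/
def EvolvesUW (β γ δ μ ν : 𝕜) (x : ℝ → State 𝕜 M) (t : ℝ) : Prop :=
  ∀ n : ℤ,
    HasSeriesDerivAt (fun s => (x s).u n)
      (μ • firstU (x t) n + ν • secondU γ δ (x t) n) t ∧
    HasSeriesDerivAt (fun s => (x s).w n)
      (μ • firstW β γ δ (x t) n + ν • secondW β γ δ (x t) n) t

/-! Local expressions in the `a n`, the `b n` and the `u n ^ γ`. -/

variable (M) in
/-- Names of the lattice variables near the origin: `a j i` and `b j i` stand for the `i`-th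
component of `a_{n+j}` and `b_{n+j}`, and `p j` stands for `u_{n+j} ^ γ`. -/
inductive Var where
  | a (j : ℤ) (i : Fin M)
  | b (j : ℤ) (i : Fin M)
  | p (j : ℤ)

variable (𝕜 M) in
/-- Polynomials in finitely many of these variables. -/
abbrev LocalPoly := MvPolynomial (Var M) 𝕜

namespace LocalPoly

/-- The row vector `a_{n+j}`. -/
def av (j : ℤ) : Fin M → LocalPoly 𝕜 M := fun i => MvPolynomial.X (Var.a j i)

/-- The column vector `b_{n+j}`. -/
def bv (j : ℤ) : Fin M → LocalPoly 𝕜 M := fun i => MvPolynomial.X (Var.b j i)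

/-- `u_{n+j} ^ γ`. -/
def p (j : ℤ) : LocalPoly 𝕜 M := MvPolynomial.X (Var.p j)

/-- The matrix `I + c * u_{n+j} ^ γ * b_{n+j} a_{n+j-1}`. -/
def mat (c : 𝕜) (j : ℤ) : Matrix (Fin M) (Fin M) (LocalPoly 𝕜 M) :=
  1 + (MvPolynomial.C c * p j : LocalPoly 𝕜 M) • Matrix.vecMulVec (bv j) (av (j - 1))

end LocalPoly

/-- The value of a variable at site `n` of a state. -/
def Var.eval (γ : 𝕜) (x : State 𝕜 M) (n : ℤ) : Var M → 𝕜⟦X⟧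
  | .a j i => x.a (n + j) i
  | .b j i => x.b (n + j) i
  | .p j => x.upow γ (n + j)

/-- The formal power series `∑ j, α ^ j * P j` with each `P j` evaluated at site `n` of a state. -/
def localSeries (γ : 𝕜) (P : ℕ → LocalPoly 𝕜 M) (x : State 𝕜 M) (n : ℤ) : 𝕜⟦X⟧ :=
  PowerSeries.mk fun m => ∑ j ∈ Finset.range (m + 1),
    PowerSeries.coeff (m - j) (MvPolynomial.aeval (Var.eval γ x n) (P j))

/-- The constraints `β u_n ^ (γ+δ) = ∑ j, α ^ j U_j` and `w_n = ∑ j, α ^ j W_j` for all `n`. -/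
def OnReduction (β γ δ : 𝕜) (U W : ℕ → LocalPoly 𝕜 M) (x : State 𝕜 M) : Prop :=
  ∀ n : ℤ, PowerSeries.C β * x.upow (γ + δ) n = localSeries γ U x n ∧
    x.w n = localSeries γ W x n

/-- At `α = 0` the relation `β u_n ^ (γ+δ) = k + (γ+δ) u_n ^ γ a_{n-1} b_n` has a nonzero derivative
with respect to `u_n` (the derivative with respect to `log u_n` is `γ+δ` times the quantity below). -/
def Nondegenerate (β γ δ : 𝕜) (x : State 𝕜 M) : Prop :=
  ∀ n : ℤ, PowerSeries.constantCoeff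
    (PowerSeries.C β * x.upow (γ + δ) n - PowerSeries.C γ * x.upow γ n * x.ab (n - 1) n) ≠ 0

/-- Given `a`, `b` and a nondegenerate solution `ℓ` (a logarithm of the leading coefficient of `u`)
of the first constraint at `α = 0`, the constraints have exactly one solution `u`, `w` extending it. -/
def DeterminesUW (β γ δ k : 𝕜) (U W : ℕ → LocalPoly 𝕜 M) : Prop :=
  ∀ (a b : ℤ → Fin M → 𝕜⟦X⟧) (ℓ : ℤ → 𝕜),
    (∀ n : ℤ, β * NormedSpace.exp ((γ + δ) * ℓ n) =
      k + (γ + δ) * NormedSpace.exp (γ * ℓ n) * PowerSeries.constantCoeff (a (n - 1) ⬝ᵥ b n)) →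
    (∀ n : ℤ, β * NormedSpace.exp ((γ + δ) * ℓ n) -
      γ * NormedSpace.exp (γ * ℓ n) * PowerSeries.constantCoeff (a (n - 1) ⬝ᵥ b n) ≠ 0) →
    ∃! lw : (ℤ → 𝕜⟦X⟧) × (ℤ → 𝕜⟦X⟧),
      (∀ n : ℤ, PowerSeries.constantCoeff (lw.1 n) = ℓ n) ∧
        OnReduction β γ δ U W ⟨a, b, lw.1, lw.2⟩

/-- The flow `∂_T = μ ∂_{t₁} + ν ∂_{t₂}` is tangent to the set cut out by the constraints: at a time
at which a curve satisfies the constraints and moves according to all the evolution equations, the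
time derivatives of the differences of the two sides of the constraints vanish. -/
def IsInvariant (β γ δ : 𝕜) (U W : ℕ → LocalPoly 𝕜 M) (μ ν : 𝕜) : Prop :=
  ∀ (x : ℝ → State 𝕜 M) (t : ℝ),
    OnReduction β γ δ U W (x t) →
    (∀ n, SeriesDifferentiableAt (fun s => (x s).logU n) t) →
    EvolvesAB β γ δ μ ν x t → EvolvesUW β γ δ μ ν x t →
    ∀ n : ℤ,
      HasSeriesDerivAt
        (fun s => PowerSeries.C β * (x s).upow (γ + δ) n - localSeries γ U (x s) n) 0 t ∧
      HasSeriesDerivAt (fun s => (x s).w n - localSeries γ W (x s) n) 0 t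

/-- With `u` and `w` given in terms of `a` and `b` by the constraints (nondegenerately), the
equations for `a` and `b` alone imply the equations for `u` and `w`. -/
def Reduces (β γ δ : 𝕜) (U W : ℕ → LocalPoly 𝕜 M) (μ ν : 𝕜) : Prop :=
  ∀ (I : Set ℝ) (x : ℝ → State 𝕜 M), IsOpen I →
    (∀ t ∈ I, OnReduction β γ δ U W (x t)) →
    (∀ t ∈ I, Nondegenerate β γ δ (x t)) →
    (∀ t ∈ I, ∀ n, SeriesDifferentiableAt (fun s => (x s).logU n) t) →
    (∀ t ∈ I, EvolvesAB β γ δ μ ν x t) →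
    ∀ t ∈ I, EvolvesUW β γ δ μ ν x t

end

end GenToda

namespace GenToda

open PowerSeries Finset

/-! ### Formal power series -/

section Series

variable {R : Type*} [CommRing R]

/-! Put `c = γ + δ` and `g(n,m) = c u_{n+1}^γ ⋯ u_m^γ a_n b_m`. Both constraints come from a single
infinite upper unitriangular matrix `Y`, defined by `k (1 - Y⁻¹)(n,m) = g(n-1,m) + α Y(n-1,m+1)` for
`n < m`. They read `v_n := β u_n^c = k + g(n-1,n) + α Y(n-1,n+1)` and `w_n = γ a_n b_n + q_n` with
`q_n = α Y(n,n+1)`. The equation for `Y` is triangular in the order in `α` and the distance `m - n`,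
so it has exactly one solution (`exists_isTriSol`, `isTriSol_unique`). It is solved once over the
ring of local polynomials and then evaluated at states; uniqueness makes the result the same at
every site (`expandHom_ypoly`).

Suppose `log u` moves as the flow prescribes, and let `A = (μ + νδ) vΛ + (μ - νγ)(αΛ⁻¹ + q)`, with
`A(n,n+1)` containing `v_{n+1}`. Then `g' = A g - g A` at the entries `n < m` (`gRate_eq`). Let
`A'(n,m) = A(n-1,m-1)`. The claim is `Y' = A Y - Y A'`, which for `C = 1 - Y⁻¹` means `C' = A - A' +
A' C - C A`. The shifted matrices `g(n-1,m)` and `Y(n-1,m+1)` both evolve by `Z ↦ A' Z - Z A`, and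
the formulas for `v` and `q` supply the term `A - A'` at the edge of the strict upper triangle.
Hence the deviation of `Y'` from `A Y - Y A'` solves a linear triangular system whose only source is
the error `ε` in the rate of `log u` (`flowDefect_eq`, `flowDefect_dvd`).

For tangency `ε = 0`, so the deviation vanishes. For the reduction, differentiating the first
constraint gives (unit) `· ε = α ·` (deviation), so divisibility of `ε` by powers of `α` improves
indefinitely and `ε = 0`. Solvability for `u` is a Newton iteration in powers of `α`
(`coeff_residual_sub`). -/

theorem dvd_of_coeff_sub {f g : R⟦X⟧} {n : ℕ} (h : ∀ m < n, coeff m f = coeff m g) :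
    (X : R⟦X⟧) ^ n ∣ f - g := by
  rw [X_pow_dvd_iff]
  intro m hm
  rw [map_sub, h m hm, sub_self]

theorem eq_zero_of_forall_X_pow_dvd {f : R⟦X⟧} (h : ∀ n : ℕ, (X : R⟦X⟧) ^ n ∣ f) : f = 0 := by
  ext m
  exact X_pow_dvd_iff.1 (h (m + 1)) m m.lt_succ_self

theorem coeff_mul_congr {f f' g g' : R⟦X⟧} {n : ℕ} (hf : ∀ m ≤ n, coeff m f = coeff m f')
    (hg : ∀ m ≤ n, coeff m g = coeff m g') : coeff n (f * g) = coeff n (f' * g') := by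
  rw [coeff_mul, coeff_mul]
  refine sum_congr rfl fun p hp => ?_
  have := mem_antidiagonal.1 hp
  rw [hf _ (by omega), hg _ (by omega)]

end Series

/-! ### The ring homomorphism `∑ α ^ j P_j ↦ ∑ α ^ j f(P_j)` into power series in `α` -/

section Expand

variable {S R : Type*} [CommRing S] [CommRing R] (f : S →+* R⟦X⟧)

noncomputable def expand (P : ℕ → S) : R⟦X⟧ :=
  PowerSeries.mk fun m => ∑ j ∈ range (m + 1), coeff (m - j) (f (P j))

theorem expand_sub_eval₂_trunc (P : S⟦X⟧) (n : ℕ) :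
    (X : R⟦X⟧) ^ n ∣ expand f (fun j => coeff j P) - (trunc n P).eval₂ f X := by
  apply dvd_of_coeff_sub
  intro m hm
  obtain ⟨k, rfl⟩ : ∃ k, n = k + 1 := ⟨n - 1, by omega⟩
  rw [Polynomial.eval₂_eq_sum_range' f (natDegree_trunc_lt P k) X, map_sum, expand, coeff_mk]
  have : range (m + 1) ⊆ range (k + 1) := range_subset_range.2 hm
  rw [← sum_subset this]
  · refine sum_congr rfl fun j hj => ?_
    have hj' := mem_range.1 hj
    rw [coeff_mul_X_pow', if_pos (by omega), coeff_trunc, if_pos (by omega)]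
  · intro j _ hj
    rw [coeff_mul_X_pow', if_neg (by simpa using hj)]

/-- Multiplicativity is checked modulo every power of `X`: there the map agrees with `eval₂ f X` of
a truncation, which is multiplicative. -/
noncomputable def expandHom : S⟦X⟧ →+* R⟦X⟧ where
  toFun P := expand f (fun j => coeff j P)
  map_zero' := by ext m; simp [expand]
  map_add' P Q := by ext m; simp [expand, sum_add_distrib]
  map_one' := by
    ext m
    rw [expand, coeff_mk, sum_eq_single_of_mem 0 (by simp)]
    · simp
    · intro j _ hj
      simp [coeff_one, hj]
  map_mul' P Q := by
    refine sub_eq_zero.1 (eq_zero_of_forall_X_pow_dvd fun n => ?_)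
    have h := expand_sub_eval₂_trunc f (P * Q) n
    have hP := expand_sub_eval₂_trunc f P n
    have hQ := expand_sub_eval₂_trunc f Q n
    have hT : (Polynomial.X : Polynomial S) ^ n ∣ trunc n P * trunc n Q - trunc n (P * Q) := by
      rw [Polynomial.X_pow_dvd_iff]
      intro d hd
      rw [Polynomial.coeff_sub, coeff_trunc, if_pos hd, coeff_mul_eq_coeff_trunc_mul_trunc P Q hd,
        sub_eq_zero, ← Polynomial.coeff_coe, Polynomial.coe_mul]
    have hT' := Polynomial.eval₂_dvd f X hT
    rw [Polynomial.eval₂_X_pow, Polynomial.eval₂_sub, Polynomial.eval₂_mul] at hT'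
    have e : ∀ a b a' b' c c' : R⟦X⟧, c - a * b =
        (c - c') - (a - a') * b - a' * (b - b') - (a' * b' - c') := by intros; ring
    rw [e _ _ _ _ _ ((trunc n (P * Q)).eval₂ f X)]
    exact dvd_sub (dvd_sub (dvd_sub h (hP.mul_right _)) (hQ.mul_left _)) hT'

theorem expandHom_C (s : S) : expandHom f (C s) = f s := by
  ext m
  change coeff m (expand f _) = _
  rw [expand, coeff_mk, sum_eq_single_of_mem 0 (by simp)]
  · simp
  · intro j _ hj
    simp [coeff_C, hj]

theorem expandHom_X : expandHom f X = X := by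
  ext m
  change coeff m (expand f _) = _
  rw [expand, coeff_mk]
  rcases m with _ | m
  · simp
  · rw [sum_eq_single_of_mem 1 (by simp)]
    · simp [coeff_X, coeff_one]
    · intro j _ hj
      simp [coeff_X, hj]

end Expand

/-! ### Fixed points of triangular maps -/

/-- Iterating `Φ` from an arbitrary start, the value at `p` no longer changes after `rk p + 1`
steps. -/
theorem exists_fixedPoint_of_rank {I S : Type*} [Nonempty S] (rk : I → ℕ)
    (Φ : (I → S) → I → S)
    (h : ∀ f f' p, (∀ q, rk q < rk p → f q = f' q) → Φ f p = Φ f' p) :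
    ∃ f, Φ f = f := by
  let F : ℕ → I → S := fun N => Φ^[N] fun _ => Classical.arbitrary S
  have hF : ∀ N, F (N + 1) = Φ (F N) := fun N => Function.iterate_succ_apply' ..
  have hs : ∀ N p, rk p < N → ∀ N', N ≤ N' → F N' p = F N p := by
    intro N
    induction N with
    | zero => intro p hp; omega
    | succ N ih =>
      intro p hp N' hN'
      obtain ⟨N', rfl⟩ : ∃ k, N' = k + 1 := ⟨N' - 1, by omega⟩
      rw [hF, hF]
      exact h _ _ _ fun q hq => ih q (by omega) N' (by omega)
  refine ⟨fun p => F (rk p + 1) p, funext fun p => ?_⟩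
  rw [hF]
  refine h _ _ _ fun q hq => ?_
  exact (hs (rk q + 1) q (by omega) (rk p) (by omega)).symm

/-! ### The exponential of a formal power series -/

section Exponential

variable {𝕜 : Type*} [RCLike 𝕜]

/-- The factor of `sexp` that is defined by formal power series only. -/
noncomputable def nexp (F : 𝕜⟦X⟧) : 𝕜⟦X⟧ :=
  PowerSeries.mk fun m => ∑ j ∈ range (m + 1), ((j.factorial : 𝕜)⁻¹) * coeff m (F ^ j)

theorem sexp_eq (f : 𝕜⟦X⟧) :
    sexp f = C (NormedSpace.exp (constantCoeff f)) * nexp (f - C (constantCoeff f)) := rfl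

/-- Since `F ^ j` starts at order `j`, any sufficiently large common cutoff may replace the one
depending on `m`; finite sums can then be differentiated. -/
theorem coeff_nexp {F : 𝕜⟦X⟧} (hF : X ∣ F) {m n : ℕ} (h : m < n) :
    coeff m (nexp F) = coeff m (∑ j ∈ range n, C ((j.factorial : 𝕜)⁻¹) * F ^ j) := by
  have : range (m + 1) ⊆ range n := range_subset_range.2 h
  rw [map_sum, nexp, coeff_mk, ← sum_subset this]
  · simp
  · intro j _ hj
    rw [coeff_C_mul, X_pow_dvd_iff.1 (pow_dvd_pow_of_dvd hF j) m (by simpa using hj), mul_zero]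

theorem X_dvd_sub_C (f : 𝕜⟦X⟧) : X ∣ f - C (constantCoeff f) := by
  rw [X_dvd_iff]; simp

theorem constantCoeff_nexp (F : 𝕜⟦X⟧) : constantCoeff (nexp F) = 1 := by
  rw [← coeff_zero_eq_constantCoeff_apply, nexp, coeff_mk]
  simp

theorem constantCoeff_sexp (f : 𝕜⟦X⟧) :
    constantCoeff (sexp f) = NormedSpace.exp (constantCoeff f) := by
  rw [sexp_eq, map_mul, constantCoeff_nexp]
  simp

theorem C_inv_factorial_succ_mul (j : ℕ) :
    (C (((j + 1).factorial : 𝕜)⁻¹) : 𝕜⟦X⟧) * ((j + 1 : ℕ) : 𝕜⟦X⟧) = C ((j.factorial : 𝕜)⁻¹) := by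
  rw [← map_natCast (C : 𝕜 →+* 𝕜⟦X⟧), ← map_mul, Nat.factorial_succ]
  congr 1
  have h1 : ((j + 1 : ℕ) : 𝕜) ≠ 0 := Nat.cast_ne_zero.2 (by omega)
  have h2 : (j.factorial : 𝕜) ≠ 0 := Nat.cast_ne_zero.2 j.factorial_ne_zero
  push_cast at h1 ⊢
  field_simp

theorem derivative_sum_pow (F : 𝕜⟦X⟧) (n : ℕ) :
    derivative 𝕜 (∑ j ∈ range (n + 1), C ((j.factorial : 𝕜)⁻¹) * F ^ j) =
      (∑ j ∈ range n, C ((j.factorial : 𝕜)⁻¹) * F ^ j) * derivative 𝕜 F := by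
  rw [map_sum, sum_range_succ', sum_mul]
  simp only [Derivation.leibniz, Derivation.leibniz_pow, derivative_C, add_zero,
    smul_eq_mul, pow_zero, Nat.add_sub_cancel, Nat.factorial_zero, map_one, mul_one,
    Nat.cast_one, inv_one, Derivation.map_one_eq_zero]
  refine sum_congr rfl fun j _ => ?_
  rw [← C_inv_factorial_succ_mul j, nsmul_eq_mul]
  ring

theorem derivative_nexp {F : 𝕜⟦X⟧} (hF : X ∣ F) :
    derivative 𝕜 (nexp F) = nexp F * derivative 𝕜 F := by
  ext m
  rw [coeff_derivative, coeff_nexp hF (Nat.lt_succ_self (m + 1)), ← coeff_derivative,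
    derivative_sum_pow]
  exact coeff_mul_congr (fun r hr => (coeff_nexp hF (by omega)).symm) fun _ _ => rfl

theorem derivative_sexp (f : 𝕜⟦X⟧) : derivative 𝕜 (sexp f) = sexp f * derivative 𝕜 f := by
  rw [sexp_eq, Derivation.leibniz, derivative_C, smul_zero, add_zero, smul_eq_mul,
    derivative_nexp (X_dvd_sub_C f), map_sub, derivative_C, sub_zero, mul_assoc]

/-- Uniqueness for a linear differential equation in `α`: coefficient `m` of the equation determines
coefficient `m + 1` of the solution, because `m + 1` is invertible. This yields the addition law for
`sexp` without manipulating binomial sums. -/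
theorem eq_of_derivative_eq_mul {y z p : 𝕜⟦X⟧} (hy : derivative 𝕜 y = y * p)
    (hz : derivative 𝕜 z = z * p) (h : constantCoeff y = constantCoeff z) : y = z := by
  have hd : derivative 𝕜 (y - z) = (y - z) * p := by rw [map_sub, hy, hz, sub_mul]
  refine sub_eq_zero.1 (eq_zero_of_forall_X_pow_dvd fun n => ?_)
  rw [X_pow_dvd_iff]
  intro m
  induction m using Nat.strong_induction_on with
  | _ m ih =>
    intro hm
    rcases m with _ | m
    · rw [coeff_zero_eq_constantCoeff_apply, map_sub, h, sub_self]
    · have h1 := congrArg (coeff m) hd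
      rw [coeff_derivative, coeff_mul, sum_eq_zero] at h1
      · have h2 : ((m : 𝕜) + 1) ≠ 0 := by exact_mod_cast Nat.succ_ne_zero m
        exact (mul_eq_zero.1 h1).resolve_right h2
      · intro r hr
        have := mem_antidiagonal.1 hr
        rw [ih r.1 (by omega) (by omega), zero_mul]

theorem sexp_add (f g : 𝕜⟦X⟧) : sexp (f + g) = sexp f * sexp g := by
  refine eq_of_derivative_eq_mul (derivative_sexp _) ?_ ?_
  · rw [Derivation.leibniz, derivative_sexp, derivative_sexp, map_add, smul_eq_mul, smul_eq_mul]
    ring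
  · rw [map_mul, constantCoeff_sexp, constantCoeff_sexp, constantCoeff_sexp, map_add,
      NormedSpace.exp_add]

theorem isUnit_sexp (f : 𝕜⟦X⟧) : IsUnit (sexp f) := by
  rw [isUnit_iff_constantCoeff, constantCoeff_sexp]
  exact NormedSpace.isUnit_exp _

/-- Terms from `h ^ 2` on have order at least `2 * m`, which is at least `m + 1`. -/
theorem sexp_sub_one_sub {h : 𝕜⟦X⟧} {m : ℕ} (hm : 1 ≤ m) (hh : (X : 𝕜⟦X⟧) ^ m ∣ h) :
    (X : 𝕜⟦X⟧) ^ (m + 1) ∣ sexp h - (1 + h) := by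
  have hX : X ∣ h := (dvd_pow_self X (by omega)).trans hh
  have h0 : constantCoeff h = 0 := X_dvd_iff.1 hX
  apply dvd_of_coeff_sub
  intro r hr
  rw [sexp_eq, h0, NormedSpace.exp_zero, map_one, one_mul, map_zero, sub_zero,
    coeff_nexp hX (show r < m + 2 by omega), sum_range_succ', sum_range_succ']
  simp only [zero_add, Nat.factorial_zero, Nat.factorial_one, Nat.cast_one, inv_one, map_one,
    one_mul, pow_zero, pow_one, map_add]
  rw [map_sum, sum_eq_zero, zero_add, add_comm]
  intro j _
  have : (X : 𝕜⟦X⟧) ^ (m + 1) ∣ C (((j + 1 + 1).factorial : 𝕜)⁻¹) * h ^ (j + 1 + 1) := by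
    refine Dvd.dvd.mul_left ?_ _
    calc (X : 𝕜⟦X⟧) ^ (m + 1) ∣ (X ^ m) ^ (j + 1 + 1) := by
          rw [← pow_mul]
          refine pow_dvd_pow _ ?_
          nlinarith
      _ ∣ _ := pow_dvd_pow_of_dvd hh _
  exact X_pow_dvd_iff.1 this r hr

end Exponential

/-! ### The triangular system -/

section Triangular

/-- The strictly upper triangular matrix `1 - Y⁻¹`. -/
def cmat {T : Type*} [CommRing T] (x κ : T) (g Y : ℤ → ℤ → T) (n m : ℤ) : T :=
  if n < m then κ * (g (n - 1) m + x * Y (n - 1) (m + 1)) else 0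

/-- `Y = 1 + C * Y` for unitriangular `Y` and strictly triangular `C = cmat x κ g Y`. -/
def IsTriSol {T : Type*} [CommRing T] (x κ : T) (g Y : ℤ → ℤ → T) : Prop :=
  ∀ n m, Y n m = (if n = m then 1 else 0) + ∑ l ∈ Ioc n m, cmat x κ g Y n l * Y l m

variable {T : Type*} [CommRing T] {x κ : T} {g Y : ℤ → ℤ → T}

theorem cmat_of_lt {n m : ℤ} (h : n < m) :
    cmat x κ g Y n m = κ * (g (n - 1) m + x * Y (n - 1) (m + 1)) := if_pos h

theorem cmat_of_le {n m : ℤ} (h : m ≤ n) : cmat x κ g Y n m = 0 := if_neg (by omega)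

theorem IsTriSol.of_lt (h : IsTriSol x κ g Y) {n m : ℤ} (hnm : m < n) : Y n m = 0 := by
  rw [h n m, if_neg (by omega), Ioc_eq_empty (by omega), sum_empty, add_zero]

theorem IsTriSol.diag (h : IsTriSol x κ g Y) (n : ℤ) : Y n n = 1 := by
  rw [h n n, if_pos rfl, Ioc_self, sum_empty, add_zero]

theorem IsTriSol.succ (h : IsTriSol x κ g Y) (n : ℤ) : Y n (n + 1) = cmat x κ g Y n (n + 1) := by
  have : Ioc n (n + 1) = {n + 1} := by ext; simp; omega
  rw [h n (n + 1), if_neg (by omega), this, sum_singleton, h.diag, zero_add, mul_one]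

theorem IsTriSol.comp_ringHom {T' : Type*} [CommRing T'] (h : IsTriSol x κ g Y) (f : T →+* T') :
    IsTriSol (f x) (f κ) (fun n m => f (g n m)) (fun n m => f (Y n m)) := by
  intro n m
  change f (Y n m) = _
  rw [h n m, map_add, map_sum, apply_ite f, map_one, map_zero]
  congr 1
  refine sum_congr rfl fun l _ => ?_
  rw [map_mul, cmat, cmat]
  split_ifs <;> simp

theorem IsTriSol.shift (h : IsTriSol x κ g Y) (s : ℤ) :
    IsTriSol x κ (fun n m => g (s + n) (s + m)) (fun n m => Y (s + n) (s + m)) := by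
  intro n m
  change Y (s + n) (s + m) = _
  rw [h (s + n) (s + m)]
  congr 1
  · simp
  · rw [← map_add_left_Ioc, sum_map]
    refine sum_congr rfl fun l _ => ?_
    rw [addLeftEmbedding_apply, cmat, cmat]
    simp only [add_lt_add_iff_left, add_sub_assoc, add_assoc]

variable {R : Type*} [CommRing R]

/-- Double induction, on the power of `X` and then on `m - n`. The entry `Y (n - 1) (l + 1)` may lie
farther from the diagonal, but it carries a factor `X`, so the previous power suffices for it. Only
entries of `g` at distance at least 2 enter the equation. -/
theorem isTriSol_congr {κ : R⟦X⟧} {g g' Y Y' : ℤ → ℤ → R⟦X⟧} (h : IsTriSol X κ g Y)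
    (h' : IsTriSol X κ g' Y') {i : ℕ}
    (hg : ∀ n m, n + 2 ≤ m → (X : R⟦X⟧) ^ i ∣ g n m - g' n m) (n m : ℤ) :
    (X : R⟦X⟧) ^ i ∣ Y n m - Y' n m := by
  suffices H : ∀ j ≤ i, ∀ d : ℕ, ∀ n m : ℤ, (m - n).toNat = d →
      (X : R⟦X⟧) ^ j ∣ Y n m - Y' n m from H i le_rfl _ n m rfl
  intro j
  induction j with
  | zero => intros; simp
  | succ j ihj =>
    intro hj d
    induction d using Nat.strong_induction_on with
    | _ d ihd =>
      intro n m hd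
      rw [h n m, h' n m, add_sub_add_left_eq_sub, ← sum_sub_distrib]
      refine dvd_sum fun l hl => ?_
      obtain ⟨h1, h2⟩ := mem_Ioc.1 hl
      rw [cmat_of_lt h1, cmat_of_lt h1]
      have e1 : (X : R⟦X⟧) ^ (j + 1) ∣ Y l m - Y' l m := ihd (m - l).toNat (by omega) l m rfl
      have e2 : (X : R⟦X⟧) ^ (j + 1) ∣ g (n - 1) l - g' (n - 1) l :=
        (pow_dvd_pow _ hj).trans (hg _ _ (by omega))
      have e3 : (X : R⟦X⟧) ^ (j + 1) ∣ X * (Y (n - 1) (l + 1) - Y' (n - 1) (l + 1)) := by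
        rw [pow_succ']
        exact mul_dvd_mul_left _ (ihj (by omega) _ _ _ rfl)
      have e : κ * (g (n - 1) l + X * Y (n - 1) (l + 1)) * Y l m -
          κ * (g' (n - 1) l + X * Y' (n - 1) (l + 1)) * Y' l m =
          κ * (g (n - 1) l + X * Y (n - 1) (l + 1)) * (Y l m - Y' l m) +
          κ * Y' l m * (g (n - 1) l - g' (n - 1) l) +
          κ * Y' l m * (X * (Y (n - 1) (l + 1) - Y' (n - 1) (l + 1))) := by ring
      rw [e]
      exact dvd_add (dvd_add (e1.mul_left _) (e2.mul_left _)) (e3.mul_left _)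

theorem isTriSol_unique {κ : R⟦X⟧} {g Y Y' : ℤ → ℤ → R⟦X⟧} (h : IsTriSol X κ g Y)
    (h' : IsTriSol X κ g Y') (n m : ℤ) : Y n m = Y' n m :=
  sub_eq_zero.1 (eq_zero_of_forall_X_pow_dvd fun _ => isTriSol_congr h h' (by simp) n m)

theorem exists_isTriSol (κ : R) (g : ℤ → ℤ → R) :
    ∃ Y : ℤ → ℤ → R⟦X⟧, IsTriSol X (C κ) (fun n m => C (g n m)) Y := by
  let Yf : (ℕ × ℤ × ℤ → R) → ℤ → ℤ → R⟦X⟧ := fun f n m => PowerSeries.mk fun i => f (i, n, m)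
  let Φ : (ℕ × ℤ × ℤ → R) → ℕ × ℤ × ℤ → R := fun f p => coeff p.1
    ((if p.2.1 = p.2.2 then 1 else 0) + ∑ l ∈ Ioc p.2.1 p.2.2,
      cmat X (C κ) (fun n m => C (g n m)) (Yf f) p.2.1 l * Yf f l p.2.2)
  -- The entry with factor `X` loses one order but its distance may grow by 2, so an order must
  -- weigh more than 2; hence the weight 3.
  have hΦ : ∀ f f' p, (∀ q : ℕ × ℤ × ℤ, 3 * q.1 + (q.2.2 - q.2.1).toNat <
      3 * p.1 + (p.2.2 - p.2.1).toNat → f q = f' q) → Φ f p = Φ f' p := by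
    rintro f f' ⟨i, n, m⟩ hff
    simp only [Φ, map_add, map_sum]
    congr 1
    refine sum_congr rfl fun l hl => ?_
    obtain ⟨h1, h2⟩ := mem_Ioc.1 hl
    rw [cmat_of_lt h1, cmat_of_lt h1]
    refine coeff_mul_congr (fun j hj => ?_) fun j hj => ?_
    · rw [coeff_C_mul, coeff_C_mul, map_add, map_add]
      rcases j with _ | j
      · simp
      · rw [coeff_succ_X_mul, coeff_succ_X_mul, coeff_mk, coeff_mk, hff]
        change 3 * j + (l + 1 - (n - 1)).toNat < 3 * i + (m - n).toNat
        omega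
    · rw [coeff_mk, coeff_mk, hff]
      change 3 * j + (m - l).toNat < 3 * i + (m - n).toNat
      omega
  obtain ⟨f, hf⟩ := exists_fixedPoint_of_rank
    (fun p : ℕ × ℤ × ℤ => 3 * p.1 + (p.2.2 - p.2.1).toNat) Φ hΦ
  refine ⟨Yf f, fun n m => ?_⟩
  ext i
  rw [coeff_mk]
  exact (congrFun hf (i, n, m)).symm

end Triangular

/-! ### Flows of the triangular system -/

section Flow

variable {T : Type*} [CommRing T]

theorem sum_Ioc_eq_sum_Icc {h : ℤ → T} {a b a' b' : ℤ} (ha : a' ≤ a + 1) (hb : b ≤ b')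
    (h0 : ∀ l, l ≤ a → h l = 0) (h1 : ∀ l, b < l → h l = 0) :
    ∑ l ∈ Ioc a b, h l = ∑ l ∈ Icc a' b', h l := by
  refine sum_subset (fun l hl => ?_) fun l _ hl' => ?_
  · rw [mem_Ioc] at hl; rw [mem_Icc]; omega
  · rw [mem_Ioc] at hl'
    rcases le_or_gt l a with h | h
    · exact h0 l h
    · exact h1 l (by omega)

theorem sum_Icc_shift {h : ℤ → T} {a b : ℤ} (ha : h a = 0) (hb : h (b + 1) = 0) :
    ∑ l ∈ Icc a b, h (l + 1) = ∑ l ∈ Icc a b, h l := by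
  have h1 : ∑ l ∈ Icc a b, h (l + 1) = ∑ l ∈ Icc (a + 1) (b + 1), h l := by
    rw [← map_add_right_Icc, sum_map]; rfl
  have h2 : ∑ l ∈ Icc a (b + 1), h l = ∑ l ∈ Icc (a + 1) (b + 1), h l := by
    symm
    refine sum_subset (Icc_subset_Icc (by omega) le_rfl) fun l hl hl' => ?_
    rw [mem_Icc] at hl hl'
    rw [show l = a by omega, ha]
  have h3 : ∑ l ∈ Icc a (b + 1), h l = ∑ l ∈ Icc a b, h l := by
    symm
    refine sum_subset (Icc_subset_Icc le_rfl (by omega)) fun l hl hl' => ?_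
    rw [mem_Icc] at hl hl'
    rw [show l = b + 1 by omega, hb]
  rw [h1, ← h2, h3]

/-- The deviation of the derivative `dY` of `Y` from the flow of `ν₁ (vΛ) + ν₂ (xΛ⁻¹ + q)`. -/
def flowDefect (x ν₁ ν₂ : T) (v q : ℤ → T) (Y dY : ℤ → ℤ → T) (n m : ℤ) : T :=
  dY n m - (ν₁ * (v (n + 1) * Y (n + 1) m - v (m - 1) * Y n (m - 1)) +
    ν₂ * (x * Y (n - 1) m - x * Y n (m + 1) + (q n - q (m - 1)) * Y n m))

variable {x κ k ν₁ ν₂ : T} {g dg Y dY err : ℤ → ℤ → T} {v q : ℤ → T}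

/-- On the diagonal this is exactly what the choice `q n = x * Y n (n + 1)` achieves; one step below
it, the two unit diagonal entries of `Y` cancel. -/
theorem flowDefect_of_le (hY : IsTriSol x κ g Y) (hdY : ∀ n m, m ≤ n → dY n m = 0)
    (hq : ∀ n, q n = x * Y n (n + 1)) {n m : ℤ} (hnm : m ≤ n) :
    flowDefect x ν₁ ν₂ v q Y dY n m = 0 := by
  rw [flowDefect, hdY n m hnm]
  have e1 : Y (n + 1) m = 0 := hY.of_lt (by omega)
  have e2 : Y n (m - 1) = 0 := hY.of_lt (by omega)
  rw [e1, e2]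
  rcases hnm.lt_or_eq with h | rfl
  · rw [hY.of_lt h]
    rcases (show m ≤ n - 1 by omega).lt_or_eq with h' | rfl
    · rw [hY.of_lt h', hY.of_lt (show m + 1 < n by omega)]; ring
    · rw [sub_add_cancel, hY.diag, hY.diag]; ring
  · have e3 := hq (m - 1)
    rw [sub_add_cancel] at e3
    rw [hY.diag, e3, hq m]; ring

/-- With `C = 1 - Y⁻¹`, differentiate `Y = 1 + C Y`. Up to `err` and the defect itself, the
derivative of `C` is `B = A - A' + A' C - C A`, and `B Y + C (A Y - Y A') = A Y - Y A'` by the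
equation for `Y`. Subtracting leaves a linear relation for the defect. -/
theorem flowDefect_eq (hκ : κ * k = 1) (hY : IsTriSol x κ g Y)
    (hdY : ∀ n m, dY n m = ∑ l ∈ Ioc n m,
      (κ * (dg (n - 1) l + x * dY (n - 1) (l + 1)) * Y l m + cmat x κ g Y n l * dY l m))
    (hv : ∀ n, v n = k + g (n - 1) n + x * Y (n - 1) (n + 1))
    (hq : ∀ n, q n = x * Y n (n + 1))
    (hdg : ∀ n m, n + 2 ≤ m → dg n m = ν₁ * (v (n + 1) * g (n + 1) m - v m * g n (m - 1)) +
      ν₂ * (x * g (n - 1) m - x * g n (m + 1) + (q n - q m) * g n m) + err n m) (n m : ℤ) :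
    flowDefect x ν₁ ν₂ v q Y dY n m = ∑ l ∈ Ioc n m,
      (cmat x κ g Y n l * flowDefect x ν₁ ν₂ v q Y dY l m +
        κ * (err (n - 1) l + x * flowDefect x ν₁ ν₂ v q Y dY (n - 1) (l + 1)) * Y l m) := by
  have hdY0 : ∀ n m, m ≤ n → dY n m = 0 := fun n m h => by
    rw [hdY, Ioc_eq_empty (by omega), sum_empty]
  have hH0 : ∀ n m, m ≤ n → flowDefect x ν₁ ν₂ v q Y dY n m = 0 :=
    fun n m h => flowDefect_of_le hY hdY0 hq h
  rcases le_or_gt m n with hnm | hnm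
  · rw [Ioc_eq_empty (by omega), sum_empty, hH0 n m hnm]
  set c := cmat x κ g Y with hc
  set H := flowDefect x ν₁ ν₂ v q Y dY with hH
  -- the tridiagonal right-hand side for the strictly triangular factor
  let B : ℤ → ℤ → T := fun n l =>
    (if l = n + 1 then ν₁ * (v (n + 1) - v n) else 0) + (if l = n then ν₂ * (q n - q (n - 1)) else 0)
    + (ν₁ * (v n * c (n + 1) l) + ν₂ * (x * c (n - 1) l + q (n - 1) * c n l))
    - (ν₁ * (c n (l - 1) * v l) + ν₂ * (x * c n (l + 1) + q l * c n l))
  have hck : ∀ n l, n < l → κ * (g (n - 1) l + x * Y (n - 1) (l + 1)) = c n l :=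
    fun n l h => (cmat_of_lt h).symm
  have hck' : ∀ n l, n < l → g (n - 1) l + x * Y (n - 1) (l + 1) = k * c n l := fun n l h => by
    rw [← hck n l h]; linear_combination (-(g (n - 1) l + x * Y (n - 1) (l + 1))) * hκ
  have hB : ∀ l, n < l → κ * (dg (n - 1) l + x * dY (n - 1) (l + 1)) =
      κ * (err (n - 1) l + x * H (n - 1) (l + 1)) + B n l := by
    intro l hl
    have d1 := hdg (n - 1) l (by omega)
    simp only [B, if_neg (show l ≠ n by omega)]
    rw [show n - 1 + 1 = n by ring] at d1
    have a1 := hck' n l hl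
    have a2 := hck' (n - 1) l (by omega)
    have a3 := hck' n (l + 1) (by omega)
    rw [d1, hH, flowDefect, show n - 1 + 1 = n by ring, show l + 1 - 1 = l by ring]
    -- Next to the diagonal the neighbours of `g` are not entries of `C`; the formula for `v`
    -- replaces them, and `v n * (v (n + 1) - k) - v (n + 1) * (v n - k) = k * (v (n + 1) - v n)`
    -- produces the entry of `A - A'`.
    by_cases hl1 : l = n + 1
    · subst hl1
      have b1 : c (n + 1) (n + 1) = 0 := cmat_of_le le_rfl
      have b2 : c n (n + 1 - 1) = 0 := cmat_of_le (by omega)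
      rw [if_pos rfl, b1, b2]
      have v1 := hv n
      have v2 := hv (n + 1)
      rw [show n + 1 - 1 = n by ring] at v2 ⊢
      linear_combination (κ * ν₂) * (q (n - 1) - q (n + 1)) * a1 + κ * ν₂ * x * a2 - κ * ν₂ * x * a3
        + (ν₂ * ((q (n - 1) - q (n + 1)) * c n (n + 1) + x * c (n - 1) (n + 1) -
          x * c n (n + 1 + 1)) + ν₁ * (v (n + 1) - v n)) * hκ
        - κ * ν₁ * v n * v2 + κ * ν₁ * v (n + 1) * v1
    · rw [if_neg hl1]
      have a4 := hck' (n + 1) l (by omega)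
      have a5 := hck' n (l - 1) (by omega)
      rw [show n + 1 - 1 = n by ring] at a4
      rw [show l - 1 + 1 = l by ring] at a5
      linear_combination (κ * ν₂) * (q (n - 1) - q l) * a1 + κ * ν₂ * x * a2 - κ * ν₂ * x * a3
        + (ν₂ * ((q (n - 1) - q l) * c n l + x * c (n - 1) l -
          x * c n (l + 1)) + ν₁ * (v n * c (n + 1) l - v l * c n (l - 1))) * hκ
        + κ * ν₁ * v n * a4 - κ * ν₁ * v l * a5
  -- On and below the diagonal `B` vanishes by the choice of `q`, so sums against `B` may run over
  -- the whole window.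
  have hB0 : ∀ l, l ≤ n → B n l = 0 := by
    intro l hl
    have b1 : c (n + 1) l = 0 := cmat_of_le (by omega)
    have b2 : c n l = 0 := cmat_of_le (by omega)
    have b3 : c n (l - 1) = 0 := cmat_of_le (by omega)
    simp only [B, if_neg (show l ≠ n + 1 by omega), b1, b2, b3]
    rcases hl.lt_or_eq with h | rfl
    · have b4 : c (n - 1) l = 0 := cmat_of_le (by omega)
      have b5 : c n (l + 1) = 0 := cmat_of_le (by omega)
      rw [if_neg (by omega), b4, b5]; ring
    · rw [if_pos rfl, hq l, hq (l - 1), hY.succ l, sub_add_cancel]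
      have := hY.succ (l - 1)
      rw [sub_add_cancel] at this
      rw [this]; ring
  -- all sums over one window
  have hsum : ∀ i j, n - 1 ≤ i → j ≤ m + 1 →
      ∑ l ∈ Icc n (m + 1), c i l * Y l j = Y i j - if i = j then 1 else 0 := by
    intro i j hi hj
    rw [hY i j, add_sub_cancel_left]
    refine (sum_Ioc_eq_sum_Icc (by omega) hj (fun l hl => ?_) fun l hl => ?_).symm
    · rw [hc, cmat_of_le hl, zero_mul]
    · rw [hY.of_lt hl, mul_zero]
  -- The matrix identity `B Y + C (A Y - Y A') = A Y - Y A'`, where `A Y - Y A'` is written as `dY -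
  -- H`.
  have key : ∑ l ∈ Icc n (m + 1), (B n l * Y l m + c n l * (dY l m - H l m)) = dY n m - H n m := by
    have e : ∀ l, dY l m - H l m = ν₁ * (v (l + 1) * Y (l + 1) m - v (m - 1) * Y l (m - 1)) +
        ν₂ * (x * Y (l - 1) m - x * Y l (m + 1) + (q l - q (m - 1)) * Y l m) := fun l => by
      rw [hH, flowDefect]; ring
    have s1 := hsum (n + 1) m (by omega) (by omega)
    have s2 := hsum (n - 1) m (by omega) (by omega)
    have s3 := hsum n m (by omega) (by omega)
    have s4 := hsum n (m - 1) (by omega) (by omega)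
    have s5 := hsum n (m + 1) (by omega) (by omega)
    have t1 := sum_Icc_shift (h := fun l => c n (l - 1) * v l * Y l m) (a := n) (b := m + 1)
      (by simp only [hc]; rw [cmat_of_le (by omega)]; ring)
      (by rw [hY.of_lt (by omega), mul_zero])
    have t2 := sum_Icc_shift (h := fun l => c n l * Y (l - 1) m) (a := n) (b := m + 1)
      (by simp only [hc]; rw [cmat_of_le (by omega)]; ring)
      (by rw [hY.of_lt (by omega), mul_zero])
    simp only [add_sub_cancel_right] at t1 t2
    have i1 : ∑ l ∈ Icc n (m + 1), (if l = n + 1 then ν₁ * (v (n + 1) - v n) else 0) * Y l m =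
        ν₁ * (v (n + 1) - v n) * Y (n + 1) m := by
      simp only [ite_mul, zero_mul]
      rw [sum_ite_eq' , if_pos (by rw [mem_Icc]; omega)]
    have i2 : ∑ l ∈ Icc n (m + 1), (if l = n then ν₂ * (q n - q (n - 1)) else 0) * Y l m =
        ν₂ * (q n - q (n - 1)) * Y n m := by
      simp only [ite_mul, zero_mul]
      rw [sum_ite_eq', if_pos (by rw [mem_Icc]; omega)]
    have expandSum : ∑ l ∈ Icc n (m + 1), (B n l * Y l m + c n l * (dY l m - H l m)) =
        ∑ l ∈ Icc n (m + 1), (if l = n + 1 then ν₁ * (v (n + 1) - v n) else 0) * Y l m +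
        ∑ l ∈ Icc n (m + 1), (if l = n then ν₂ * (q n - q (n - 1)) else 0) * Y l m +
        ν₁ * v n * ∑ l ∈ Icc n (m + 1), c (n + 1) l * Y l m +
        ν₂ * x * ∑ l ∈ Icc n (m + 1), c (n - 1) l * Y l m +
        ν₂ * (q (n - 1) - q (m - 1)) * ∑ l ∈ Icc n (m + 1), c n l * Y l m -
        ν₁ * ∑ l ∈ Icc n (m + 1), c n (l - 1) * v l * Y l m -
        ν₂ * x * ∑ l ∈ Icc n (m + 1), c n (l + 1) * Y l m +
        ν₁ * ∑ l ∈ Icc n (m + 1), c n l * v (l + 1) * Y (l + 1) m -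
        ν₁ * v (m - 1) * ∑ l ∈ Icc n (m + 1), c n l * Y l (m - 1) +
        ν₂ * x * ∑ l ∈ Icc n (m + 1), c n l * Y (l - 1) m -
        ν₂ * x * ∑ l ∈ Icc n (m + 1), c n l * Y l (m + 1) := by
      simp only [mul_sum, ← sum_add_distrib, ← sum_sub_distrib]
      refine sum_congr rfl fun l _ => ?_
      rw [e]
      simp only [B]
      ring
    rw [expandSum, i1, i2, s1, s2, s3, s4, s5, t1, ← t2, e n, if_neg (show n - 1 ≠ m by omega),
      if_neg (show n ≠ m by omega), if_neg (show n ≠ m + 1 by omega)]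
    have j1 : (if n + 1 = m then (1 : T) else 0) * v n =
        (if n = m - 1 then (1 : T) else 0) * v (m - 1) := by
      by_cases h : n + 1 = m
      · rw [if_pos h, if_pos (by omega), show m - 1 = n by omega]
      · rw [if_neg h, if_neg (by omega)]; ring
    linear_combination (-ν₁) * j1
  have key' : dY n m = ∑ l ∈ Icc n (m + 1),
      ((if n < l then κ * (err (n - 1) l + x * H (n - 1) (l + 1)) else 0) * Y l m + B n l * Y l m +
        c n l * dY l m) := by
    rw [hdY, ← sum_Ioc_eq_sum_Icc (a := n) (b := m) (by omega) (by omega)]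
    · refine sum_congr rfl fun l hl => ?_
      have hl' := (mem_Ioc.1 hl).1
      rw [hB l hl', if_pos hl']; ring
    · intro l hl
      rw [if_neg (by omega), hB0 l hl, hc, cmat_of_le hl]; ring
    · intro l hl
      rw [hY.of_lt hl, hdY0 l m hl.le]; ring
  have fin : H n m = ∑ l ∈ Icc n (m + 1), (c n l * H l m +
      (if n < l then κ * (err (n - 1) l + x * H (n - 1) (l + 1)) else 0) * Y l m) := by
    have : H n m = dY n m - (dY n m - H n m) := by ring
    rw [this, ← key, key', ← sum_sub_distrib]
    refine sum_congr rfl fun l _ => ?_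
    ring
  rw [fin, ← sum_Ioc_eq_sum_Icc (a := n) (b := m) (by omega) (by omega)]
  · refine sum_congr rfl fun l hl => ?_
    rw [if_pos (mem_Ioc.1 hl).1]
  · intro l hl
    rw [if_neg (by omega), hc, cmat_of_le hl]; ring
  · intro l hl
    rw [hY.of_lt hl, hH0 l m hl.le]; ring

end Flow

/-! ### Time derivatives of curves of power series -/

section Calculus

variable {𝕜 : Type*} [RCLike 𝕜] {f g : ℝ → 𝕜⟦X⟧} {f' g' : 𝕜⟦X⟧} {t : ℝ}

namespace HasSeriesDerivAt

theorem const (c : 𝕜⟦X⟧) (t : ℝ) : HasSeriesDerivAt (fun _ => c) 0 t := fun m => by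
  simpa using hasDerivAt_const t (coeff m c)

theorem add (hf : HasSeriesDerivAt f f' t) (hg : HasSeriesDerivAt g g' t) :
    HasSeriesDerivAt (fun s => f s + g s) (f' + g') t := fun m => by
  simpa using (hf m).fun_add (hg m)

theorem sub (hf : HasSeriesDerivAt f f' t) (hg : HasSeriesDerivAt g g' t) :
    HasSeriesDerivAt (fun s => f s - g s) (f' - g') t := fun m => by
  simpa using (hf m).fun_sub (hg m)

theorem sum {ι : Type*} {F : ι → ℝ → 𝕜⟦X⟧} {F' : ι → 𝕜⟦X⟧} (s : Finset ι)
    (h : ∀ i ∈ s, HasSeriesDerivAt (F i) (F' i) t) :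
    HasSeriesDerivAt (fun r => ∑ i ∈ s, F i r) (∑ i ∈ s, F' i) t := fun m => by
  simpa using HasDerivAt.fun_sum fun i hi => h i hi m

theorem mul (hf : HasSeriesDerivAt f f' t) (hg : HasSeriesDerivAt g g' t) :
    HasSeriesDerivAt (fun s => f s * g s) (f' * g t + f t * g') t := fun m => by
  simp only [coeff_mul, map_add, ← sum_add_distrib]
  exact HasDerivAt.fun_sum fun p _ => (hf p.1).mul (hg p.2)

theorem const_mul (c : 𝕜⟦X⟧) (hf : HasSeriesDerivAt f f' t) :
    HasSeriesDerivAt (fun s => c * f s) (c * f') t := by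
  simpa using (const c t).mul hf

theorem pow (hf : HasSeriesDerivAt f f' t) (j : ℕ) :
    HasSeriesDerivAt (fun s => f s ^ j) (j * f t ^ (j - 1) * f') t := by
  induction j with
  | zero => simpa using const (1 : 𝕜⟦X⟧) t
  | succ j ih =>
    have h := ih.mul hf
    simp only [← pow_succ] at h
    convert! h using 1
    rcases j with _ | j
    · simp
    · push_cast
      ring

theorem prod_of_log {ι : Type*} {F : ι → ℝ → 𝕜⟦X⟧} {F' : ι → 𝕜⟦X⟧} (s : Finset ι)
    (h : ∀ i ∈ s, HasSeriesDerivAt (F i) (F i t * F' i) t) :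
    HasSeriesDerivAt (fun r => ∏ i ∈ s, F i r) ((∏ i ∈ s, F i t) * ∑ i ∈ s, F' i) t := by
  classical
  induction s using Finset.induction_on with
  | empty => simpa using const (1 : 𝕜⟦X⟧) t
  | insert i s hi ih =>
    simp only [prod_insert hi, sum_insert hi]
    convert! (h i (mem_insert_self i s)).mul (ih fun j hj => h j (mem_insert_of_mem hj)) using 1
    ring

theorem unique {f₁' f₂' : 𝕜⟦X⟧} (h₁ : HasSeriesDerivAt f f₁' t) (h₂ : HasSeriesDerivAt f f₂' t) :
    f₁' = f₂' := by
  ext m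
  exact (h₁ m).unique (h₂ m)

theorem congr_of_eventuallyEq (hf : HasSeriesDerivAt f f' t) (h : ∀ᶠ s in nhds t, g s = f s) :
    HasSeriesDerivAt g f' t := fun m =>
  (hf m).congr_of_eventuallyEq (h.mono fun _ hs => congrArg (coeff m) hs)

theorem nexp (hf : HasSeriesDerivAt f f' t) (h0 : ∀ s, X ∣ f s) (h0' : X ∣ f') :
    HasSeriesDerivAt (fun s => nexp (f s)) (GenToda.nexp (f t) * f') t := fun m => by
  have h := (sum (range (m + 1)) fun j _ =>
    ((hf.pow j).const_mul (C ((j.factorial : 𝕜)⁻¹)))) m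
  simp only [fun s => coeff_nexp (h0 s) (Nat.lt_succ_self m)]
  convert! h using 1
  have e : ∑ j ∈ range (m + 1), C ((j.factorial : 𝕜)⁻¹) * (j * f t ^ (j - 1) * f') =
      (∑ j ∈ range m, C ((j.factorial : 𝕜)⁻¹) * f t ^ j) * f' := by
    rw [sum_range_succ', sum_mul]
    simp only [Nat.cast_zero, zero_mul, mul_zero, add_zero, Nat.add_sub_cancel]
    refine sum_congr rfl fun j _ => ?_
    rw [← C_inv_factorial_succ_mul j]
    ring
  rw [e]
  -- Differentiation shortens the exponential sum by one term. The factor `X` in `f'` compensates: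
  -- only coefficients below `m` of that sum are used, and these are exact.
  obtain ⟨d, rfl⟩ := h0'
  rw [mul_left_comm, mul_left_comm _ X d]
  rcases m with _ | m
  · simp
  · rw [coeff_succ_X_mul, coeff_succ_X_mul]
    exact coeff_mul_congr (fun r hr => coeff_nexp (h0 t) (by omega)) fun _ _ => rfl

theorem sexp (hf : HasSeriesDerivAt f f' t) :
    HasSeriesDerivAt (fun s => sexp (f s)) (GenToda.sexp (f t) * f') t := by
  have hC : HasSeriesDerivAt (fun s => C (constantCoeff (f s))) (C (constantCoeff f')) t := by
    intro m
    rcases m with _ | m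
    · simpa using hf 0
    · simpa [coeff_C] using hasDerivAt_const t (0 : 𝕜)
  have hE : HasSeriesDerivAt (fun s => C (NormedSpace.exp (constantCoeff (f s))))
      (C (NormedSpace.exp (constantCoeff (f t)) * constantCoeff f')) t := by
    intro m
    rcases m with _ | m
    · have h0 : HasDerivAt (fun s => constantCoeff (f s)) (constantCoeff f') t := by
        simpa using hf 0
      simpa [Function.comp_def] using
        (hasDerivAt_exp (𝕂 := 𝕜) (x := constantCoeff (f t))).comp t h0
    · simpa [coeff_C] using hasDerivAt_const t (0 : 𝕜)
  have h := hE.mul ((hf.sub hC).nexp (fun s => X_dvd_sub_C (f s)) (X_dvd_sub_C f'))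
  simp only [← sexp_eq] at h
  convert! h using 1
  rw [sexp_eq, map_mul]
  ring

end HasSeriesDerivAt

namespace SeriesDifferentiableAt

theorem exists_hasSeriesDerivAt (h : SeriesDifferentiableAt f t) :
    ∃ f', HasSeriesDerivAt f f' t :=
  ⟨PowerSeries.mk fun m => deriv (fun s => coeff m (f s)) t, fun m => by
    rw [coeff_mk]; exact (h m).hasDerivAt⟩

end SeriesDifferentiableAt

theorem HasSeriesDerivAt.seriesDifferentiableAt (h : HasSeriesDerivAt f f' t) :
    SeriesDifferentiableAt f t := fun m => (h m).differentiableAt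

theorem seriesDifferentiableAt_aeval {ι : Type*} {V : ι → ℝ → 𝕜⟦X⟧}
    (hV : ∀ i, SeriesDifferentiableAt (V i) t) (P : MvPolynomial ι 𝕜) :
    SeriesDifferentiableAt (fun s => MvPolynomial.aeval (fun i => V i s) P) t := by
  suffices ∃ f', HasSeriesDerivAt (fun s => MvPolynomial.aeval (fun i => V i s) P) f' t from
    this.choose_spec.seriesDifferentiableAt
  induction P using MvPolynomial.induction_on with
  | C r => exact ⟨0, by simpa using HasSeriesDerivAt.const _ t⟩
  | add P Q hP hQ =>
    obtain ⟨p, hp⟩ := hP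
    obtain ⟨q, hq⟩ := hQ
    exact ⟨_, by simpa using hp.add hq⟩
  | mul_X P i hP =>
    obtain ⟨p, hp⟩ := hP
    obtain ⟨q, hq⟩ := (hV i).exists_hasSeriesDerivAt
    exact ⟨_, by simpa using hp.mul hq⟩

end Calculus

/-! ### The reduction -/

section Reduction

variable {𝕜 : Type*} [RCLike 𝕜] {M : ℕ}

open LocalPoly in
/-- The polynomial `c * u_{n+1}^γ ⋯ u_m^γ * a_n b_m`. -/
noncomputable def gpoly (M : ℕ) (c : 𝕜) (n m : ℤ) : LocalPoly 𝕜 M :=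
  MvPolynomial.C c * (∏ i ∈ Ioc n m, p i) * (av n ⬝ᵥ bv m)

/-- The universal solution, independent of any state; its coefficients are the source of the
polynomials in the constraints. -/
noncomputable def ypoly (M : ℕ) (c κ : 𝕜) : ℤ → ℤ → (LocalPoly 𝕜 M)⟦X⟧ :=
  (exists_isTriSol (MvPolynomial.C κ) (gpoly M c)).choose

theorem ypoly_isTriSol (M : ℕ) (c κ : 𝕜) :
    IsTriSol X (C (MvPolynomial.C κ)) (fun n m => C (gpoly M c n m)) (ypoly M c κ) :=
  (exists_isTriSol (MvPolynomial.C κ) (gpoly M c)).choose_spec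

/-- The right-hand side of the constraint for `β u ^ (γ + δ)`. -/
noncomputable def useries (M : ℕ) (c k : 𝕜) : (LocalPoly 𝕜 M)⟦X⟧ :=
  C (MvPolynomial.C k + gpoly M c (-1) 0) + X * ypoly M c k⁻¹ (-1) 1

open LocalPoly in
/-- The right-hand side of the constraint for `w`. -/
noncomputable def wseries (M : ℕ) (γ c k : 𝕜) : (LocalPoly 𝕜 M)⟦X⟧ :=
  C (MvPolynomial.C γ * (av 0 ⬝ᵥ bv 0)) + X * ypoly M c k⁻¹ 0 1

namespace State

noncomputable def g (γ c : 𝕜) (x : State 𝕜 M) (n m : ℤ) : 𝕜⟦X⟧ :=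
  C c * (∏ i ∈ Ioc n m, x.upow γ i) * x.ab n m

noncomputable def y (γ c κ : 𝕜) (x : State 𝕜 M) (n m : ℤ) : 𝕜⟦X⟧ :=
  expandHom (MvPolynomial.aeval (Var.eval γ x 0)).toRingHom (ypoly M c κ n m)

end State

theorem aeval_gpoly (γ c : 𝕜) (x : State 𝕜 M) (s n m : ℤ) :
    MvPolynomial.aeval (Var.eval γ x s) (gpoly M c n m) = x.g γ c (s + n) (s + m) := by
  rw [gpoly, map_mul, map_mul, map_prod, MvPolynomial.aeval_C, State.g, ← map_add_left_Ioc,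
    prod_map]
  simp [LocalPoly.p, LocalPoly.av, LocalPoly.bv, Var.eval, State.ab, dotProduct]

theorem expandHom_ypoly_isTriSol (γ c κ : 𝕜) (x : State 𝕜 M) (s : ℤ) :
    IsTriSol X (C κ) (fun n m => x.g γ c (s + n) (s + m)) (fun n m =>
      expandHom (MvPolynomial.aeval (Var.eval γ x s)).toRingHom (ypoly M c κ n m)) := by
  let F : (LocalPoly 𝕜 M)⟦X⟧ →+* 𝕜⟦X⟧ :=
    expandHom (MvPolynomial.aeval (Var.eval γ x s)).toRingHom
  have h := (ypoly_isTriSol M c κ).comp_ringHom F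
  simp only [F] at h
  rw [expandHom_X] at h
  simpa [expandHom_C, aeval_gpoly, PowerSeries.algebraMap_apply] using h

theorem State.y_isTriSol (γ c κ : 𝕜) (x : State 𝕜 M) :
    IsTriSol X (C κ) (x.g γ c) (x.y γ c κ) := by
  have h := expandHom_ypoly_isTriSol γ c κ x 0
  simp only [zero_add] at h
  exact h

/-- Evaluation at site `s` and translation by `s` of the evaluation at site 0 solve the same
triangular system, so uniqueness identifies them. Thus one polynomial serves all sites. -/
theorem expandHom_ypoly (γ c κ : 𝕜) (x : State 𝕜 M) (s n m : ℤ) :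
    expandHom (MvPolynomial.aeval (Var.eval γ x s)).toRingHom (ypoly M c κ n m) =
      x.y γ c κ (s + n) (s + m) :=
  isTriSol_unique (expandHom_ypoly_isTriSol γ c κ x s) ((x.y_isTriSol γ c κ).shift s) n m

theorem localSeries_coeff (γ : 𝕜) (Q : (LocalPoly 𝕜 M)⟦X⟧) (x : State 𝕜 M) (n : ℤ) :
    localSeries γ (fun j => coeff j Q) x n =
      expandHom (MvPolynomial.aeval (Var.eval γ x n)).toRingHom Q := rfl

theorem localSeries_useries (γ c k : 𝕜) (x : State 𝕜 M) (n : ℤ) :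
    localSeries γ (fun j => coeff j (useries M c k)) x n =
      C k + x.g γ c (n - 1) n + X * x.y γ c k⁻¹ (n - 1) (n + 1) := by
  rw [localSeries_coeff, useries, map_add, map_mul, expandHom_X, expandHom_ypoly, expandHom_C]
  simp [aeval_gpoly, sub_eq_add_neg]

theorem localSeries_wseries (γ c k : 𝕜) (x : State 𝕜 M) (n : ℤ) :
    localSeries γ (fun j => coeff j (wseries M γ c k)) x n =
      C γ * x.ab n n + X * x.y γ c k⁻¹ n (n + 1) := by
  rw [localSeries_coeff, wseries, map_add, map_mul _ X, expandHom_X, expandHom_ypoly, expandHom_C]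
  simp [LocalPoly.av, LocalPoly.bv, Var.eval, State.ab, dotProduct]

end Reduction

/-! ### The coefficients of low order -/

section LowOrder

variable {R : Type*} [CommRing R] {κ : R} {g : ℤ → ℤ → R} {Y : ℤ → ℤ → R⟦X⟧}

/-- At `α = 0` the system no longer feeds `Y` back into `C`, so near-diagonal entries are explicit
finite sums; the displayed low-order coefficients follow from them. -/
theorem IsTriSol.constantCoeff (h : IsTriSol X (C κ) (fun n m => C (g n m)) Y) :
    IsTriSol 0 κ g fun n m => constantCoeff (Y n m) := by
  let F : R⟦X⟧ →+* R := PowerSeries.constantCoeff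
  simpa [F] using h.comp_ringHom F

theorem IsTriSol.succ_of_zero {y : ℤ → ℤ → R} (h : IsTriSol 0 κ g y) (n : ℤ) :
    y n (n + 1) = κ * g (n - 1) (n + 1) := by
  rw [h.succ, cmat_of_lt (by omega)]; ring

theorem IsTriSol.add_two_of_zero {y : ℤ → ℤ → R} (h : IsTriSol 0 κ g y) (n : ℤ) :
    y n (n + 2) = κ * g (n - 1) (n + 1) * (κ * g n (n + 2)) + κ * g (n - 1) (n + 2) := by
  have e : Ioc n (n + 2) = {n + 1, n + 2} := by ext; simp; omega
  have e1 := h.succ_of_zero (n + 1)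
  rw [add_assoc, one_add_one_eq_two, add_sub_cancel_right] at e1
  rw [h n (n + 2), e, sum_pair (by omega), if_neg (by omega), cmat_of_lt (by omega),
    cmat_of_lt (by omega), h.diag, e1]
  ring

theorem IsTriSol.add_three_of_zero {y : ℤ → ℤ → R} (h : IsTriSol 0 κ g y) (n : ℤ) :
    y n (n + 3) = κ * g (n - 1) (n + 1) *
      (κ * g n (n + 2) * (κ * g (n + 1) (n + 3)) + κ * g n (n + 3)) +
      κ * g (n - 1) (n + 2) * (κ * g (n + 1) (n + 3)) + κ * g (n - 1) (n + 3) := by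
  have e : Ioc n (n + 3) = {n + 1, n + 2, n + 3} := by ext; simp; omega
  have e1 := h.add_two_of_zero (n + 1)
  have e2 := h.succ_of_zero (n + 2)
  rw [show n + 1 + 2 = n + 3 by ring, show n + 1 + 1 = n + 2 by ring, add_sub_cancel_right] at e1
  rw [show n + 2 + 1 = n + 3 by ring, show n + 2 - 1 = n + 1 by ring] at e2
  rw [h n (n + 3), e, sum_insert (by simp), sum_pair (by omega), if_neg (by omega),
    cmat_of_lt (by omega), cmat_of_lt (by omega), cmat_of_lt (by omega), h.diag, e1, e2]
  ring

theorem IsTriSol.coeff_one_succ (h : IsTriSol X (C κ) (fun n m => C (g n m)) Y) (n : ℤ) :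
    coeff 1 (Y n (n + 1)) = κ * PowerSeries.constantCoeff (Y (n - 1) (n + 2)) := by
  rw [h.succ, cmat_of_lt (by omega), coeff_C_mul, map_add, coeff_C, if_neg one_ne_zero, zero_add,
    show (1 : ℕ) = 0 + 1 from rfl, coeff_succ_X_mul, coeff_zero_eq_constantCoeff_apply, add_assoc,
    one_add_one_eq_two]

variable {𝕜 : Type*} [RCLike 𝕜] {M : ℕ}

theorem mat_mulVec (c : 𝕜) (j : ℤ) (v : Fin M → LocalPoly 𝕜 M) :
    (LocalPoly.mat c j).mulVec v =
      v + (MvPolynomial.C c * LocalPoly.p j * (LocalPoly.av (j - 1) ⬝ᵥ v)) • LocalPoly.bv j := by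
  rw [LocalPoly.mat, Matrix.add_mulVec, Matrix.one_mulVec, Matrix.smul_mulVec,
    Matrix.vecMulVec_mulVec]
  simp [smul_smul]

open LocalPoly

theorem coeff_zero_useries (c k : 𝕜) : coeff 0 (useries M c k) =
    MvPolynomial.C k + MvPolynomial.C c * p 0 * (av (-1) ⬝ᵥ bv 0) := by
  have e : Ioc (-1 : ℤ) 0 = {0} := rfl
  rw [useries, map_add, coeff_zero_C, coeff_zero_X_mul, gpoly, e, prod_singleton, add_zero]

theorem coeff_one_useries (c k : 𝕜) : coeff 1 (useries M c k) =
    MvPolynomial.C (c / k) * (p (-1) * p 0 * p 1) *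
        (av (-2) ⬝ᵥ Matrix.mulVec (mat (c / k) 0) (bv 1)) := by
  have e1 : Ioc (-2 : ℤ) 0 = {-1, 0} := rfl
  have e2 : Ioc (-1 : ℤ) 1 = {0, 1} := rfl
  have e3 : Ioc (-2 : ℤ) 1 = {-1, 0, 1} := rfl
  have h := (ypoly_isTriSol M c k⁻¹).constantCoeff.add_two_of_zero (-1)
  norm_num at h
  rw [useries, map_add, coeff_C, if_neg one_ne_zero, show (1 : ℕ) = 0 + 1 from rfl,
    coeff_succ_X_mul, coeff_zero_eq_constantCoeff_apply, h, mat_mulVec, div_eq_mul_inv, map_mul,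
    dotProduct_add, dotProduct_smul, smul_eq_mul, gpoly, gpoly, gpoly, e1, e2, e3,
    prod_pair (by decide), prod_pair (by decide), prod_insert (by decide), prod_pair (by decide)]
  rw [zero_sub]
  ring

theorem coeff_zero_wseries (γ c k : 𝕜) : coeff 0 (wseries M γ c k) =
    MvPolynomial.C γ * (av 0 ⬝ᵥ bv 0) := by
  rw [wseries, map_add, coeff_zero_C, coeff_zero_X_mul, add_zero]

theorem coeff_one_wseries (γ c k : 𝕜) : coeff 1 (wseries M γ c k) =
    MvPolynomial.C (c / k) * (p 0 * p 1) * (av (-1) ⬝ᵥ bv 1) := by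
  have e2 : Ioc (-1 : ℤ) 1 = {0, 1} := rfl
  have h := (ypoly_isTriSol M c k⁻¹).constantCoeff.succ_of_zero 0
  norm_num at h
  rw [wseries, map_add, coeff_C, if_neg one_ne_zero, show (1 : ℕ) = 0 + 1 from rfl,
    coeff_succ_X_mul, coeff_zero_eq_constantCoeff_apply, h, gpoly, e2, prod_pair (by decide),
    div_eq_mul_inv, map_mul]
  ring

theorem coeff_two_wseries (γ c k : 𝕜) : coeff 2 (wseries M γ c k) =
    MvPolynomial.C (c / k ^ 2) * (p (-1) * p 0 * p 1 * p 2) *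
        (av (-2) ⬝ᵥ Matrix.mulVec (mat (c / k) 0 * mat (c / k) 1) (bv 2)) := by
  have e1 : Ioc (-2 : ℤ) 0 = {-1, 0} := rfl
  have e2 : Ioc (-1 : ℤ) 1 = {0, 1} := rfl
  have e3 : Ioc (-2 : ℤ) 1 = {-1, 0, 1} := rfl
  have e4 : Ioc (-2 : ℤ) 2 = {-1, 0, 1, 2} := rfl
  have e5 : Ioc (-1 : ℤ) 2 = {0, 1, 2} := rfl
  have e6 : Ioc (0 : ℤ) 2 = {1, 2} := rfl
  have h := (ypoly_isTriSol M c k⁻¹).constantCoeff.add_three_of_zero (-1)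
  have h' := (ypoly_isTriSol M c k⁻¹).coeff_one_succ 0
  norm_num at h h'
  rw [wseries, map_add, coeff_C, if_neg two_ne_zero, show (2 : ℕ) = 1 + 1 from rfl,
    coeff_succ_X_mul, h', h, ← Matrix.mulVec_mulVec, mat_mulVec, mat_mulVec]
  simp only [gpoly, e1, e2, e3, e4, e5, e6, dotProduct_add, dotProduct_smul, smul_eq_mul,
    div_eq_mul_inv, map_mul, ← inv_pow, map_pow, zero_sub, sub_self]
  rw [prod_pair (by decide), prod_pair (by decide), prod_pair (by decide),
    prod_insert (by decide), prod_pair (by decide), prod_insert (by decide), prod_pair (by decide),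
    prod_insert (by decide), prod_insert (by decide), prod_pair (by decide)]
  ring

end LowOrder

/-! ### Solving the constraints for `u` and `w` -/

section Determination

theorem dvd_prod_sub_prod {ι R : Type*} [CommRing R] {d : R} {f f' : ι → R} (s : Finset ι)
    (h : ∀ i ∈ s, d ∣ f i - f' i) : d ∣ ∏ i ∈ s, f i - ∏ i ∈ s, f' i := by
  classical
  induction s using Finset.induction_on with
  | empty => simp
  | insert i s hi ih =>
    rw [prod_insert hi, prod_insert hi]
    have e : f i * ∏ j ∈ s, f j - f' i * ∏ j ∈ s, f' j =
      (f i - f' i) * ∏ j ∈ s, f j + f' i * (∏ j ∈ s, f j - ∏ j ∈ s, f' j) := by ring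
    rw [e]
    exact dvd_add ((h i (mem_insert_self i s)).mul_right _)
      ((ih fun j hj => h j (mem_insert_of_mem hj)).mul_left _)

theorem coeff_mul_of_X_pow_dvd {R : Type*} [CommRing R] {f h : R⟦X⟧} {m : ℕ}
    (hh : (X : R⟦X⟧) ^ m ∣ h) : coeff m (f * h) = constantCoeff f * coeff m h := by
  obtain ⟨h, rfl⟩ := hh
  rw [mul_left_comm, coeff_X_pow_mul', coeff_X_pow_mul', if_pos le_rfl, if_pos le_rfl]
  simp

variable {𝕜 : Type*} [RCLike 𝕜] {M : ℕ}

theorem sexp_smul_sub {s : 𝕜} {L L' : 𝕜⟦X⟧} {m : ℕ} (hm : 1 ≤ m) (h : (X : 𝕜⟦X⟧) ^ m ∣ L - L') :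
    (X : 𝕜⟦X⟧) ^ m ∣ sexp (s • L) - sexp (s • L') ∧
    coeff m (sexp (s • L) - sexp (s • L')) =
      s * NormedSpace.exp (s * constantCoeff L') * coeff m (L - L') := by
  have h1 : (X : 𝕜⟦X⟧) ^ m ∣ s • (L - L') := by
    rw [smul_eq_C_mul]; exact h.mul_left _
  have h2 := sexp_sub_one_sub hm h1
  have e : sexp (s • L) - sexp (s • L') =
      sexp (s • L') * (sexp (s • (L - L')) - (1 + s • (L - L'))) +
        sexp (s • L') * (s • (L - L')) := by
    rw [mul_sub, ← sexp_add, ← smul_add, add_sub_cancel]; ring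
  rw [e]
  refine ⟨dvd_add (((pow_dvd_pow _ (by omega)).trans h2).mul_left _) (h1.mul_left _), ?_⟩
  rw [map_add, X_pow_dvd_iff.1 (h2.mul_left (sexp (s • L'))) m (by omega), zero_add,
    coeff_mul_of_X_pow_dvd h1, constantCoeff_sexp, smul_eq_C_mul, smul_eq_C_mul, coeff_C_mul,
    map_mul, constantCoeff_C]
  ring

namespace State

theorem g_sub_dvd {γ c : 𝕜} {x x' : State 𝕜 M} (ha : x.a = x'.a) (hb : x.b = x'.b) {m : ℕ}
    (h : ∀ n, (X : 𝕜⟦X⟧) ^ m ∣ x.logU n - x'.logU n) (i j : ℤ) :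
    (X : 𝕜⟦X⟧) ^ m ∣ x.g γ c i j - x'.g γ c i j := by
  have hab : x.ab i j = x'.ab i j := by rw [ab, ab, ha, hb]
  rw [g, g, hab, ← sub_mul, ← mul_sub]
  refine (Dvd.dvd.mul_left (dvd_prod_sub_prod _ fun l _ => ?_) _).mul_right _
  rcases m with _ | m
  · simp
  · exact (sexp_smul_sub (by omega) (h l)).1

theorem g_pred (γ c : 𝕜) (x : State 𝕜 M) (n : ℤ) :
    x.g γ c (n - 1) n = C c * x.upow γ n * x.ab (n - 1) n := by
  have : Ioc (n - 1) n = {n} := by ext; simp; omega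
  rw [g, this, prod_singleton]

end State

theorem localSeries_congr {γ : 𝕜} {x x' : State 𝕜 M} (ha : x.a = x'.a) (hb : x.b = x'.b)
    (hl : x.logU = x'.logU) (P : ℕ → LocalPoly 𝕜 M) (n : ℤ) :
    localSeries γ P x n = localSeries γ P x' n := by
  have : Var.eval γ x n = Var.eval γ x' n := by
    funext V
    cases V <;> simp only [Var.eval, State.upow, ha, hb, hl]
  rw [localSeries, this, localSeries]

/-- The difference of the two sides of the first constraint. -/
noncomputable def residual (β γ δ k : 𝕜) (x : State 𝕜 M) (n : ℤ) : 𝕜⟦X⟧ :=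
  C β * x.upow (γ + δ) n - localSeries γ (fun j => coeff j (useries M (γ + δ) k)) x n

/-- A change of `log u` at order `m` reaches the tail `X * y` only at order `m + 1`. At order `m`
only the explicit powers of `u n` respond, through their derivative with respect to `log u n`. -/
theorem coeff_residual_sub {β γ δ k : 𝕜} {x x' : State 𝕜 M} (ha : x.a = x'.a) (hb : x.b = x'.b)
    {m : ℕ} (hm : 1 ≤ m) (h : ∀ n, (X : 𝕜⟦X⟧) ^ m ∣ x.logU n - x'.logU n) (n : ℤ) :
    coeff m (residual β γ δ k x n) - coeff m (residual β γ δ k x' n) =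
      (γ + δ) * (β * NormedSpace.exp ((γ + δ) * constantCoeff (x'.logU n)) -
        γ * NormedSpace.exp (γ * constantCoeff (x'.logU n)) * constantCoeff (x'.ab (n - 1) n)) *
      coeff m (x.logU n - x'.logU n) := by
  have hab : x.ab (n - 1) n = x'.ab (n - 1) n := by rw [State.ab, State.ab, ha, hb]
  have hy : (X : 𝕜⟦X⟧) ^ (m + 1) ∣ X * (x.y γ (γ + δ) k⁻¹ (n - 1) (n + 1) -
      x'.y γ (γ + δ) k⁻¹ (n - 1) (n + 1)) := by
    rw [pow_succ']
    exact mul_dvd_mul_left _ (isTriSol_congr (x.y_isTriSol γ _ _) (x'.y_isTriSol γ _ _)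
      (fun i j _ => State.g_sub_dvd ha hb h i j) _ _)
  obtain ⟨_, h1⟩ := sexp_smul_sub (s := γ + δ) hm (h n)
  obtain ⟨hp, h2⟩ := sexp_smul_sub (s := γ) hm (h n)
  have e : residual β γ δ k x n - residual β γ δ k x' n =
      C β * (x.upow (γ + δ) n - x'.upow (γ + δ) n)
        - C (γ + δ) * (x'.ab (n - 1) n * (x.upow γ n - x'.upow γ n))
        - X * (x.y γ (γ + δ) k⁻¹ (n - 1) (n + 1) - x'.y γ (γ + δ) k⁻¹ (n - 1) (n + 1)) := by
    rw [residual, residual, localSeries_useries, localSeries_useries, State.g_pred, State.g_pred,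
      hab]
    ring
  rw [← map_sub, e, map_sub, map_sub, X_pow_dvd_iff.1 hy m (by omega), coeff_C_mul, coeff_C_mul]
  simp only [State.upow]
  rw [coeff_mul_of_X_pow_dvd hp, h1, h2]
  ring

theorem constantCoeff_residual (β γ δ k : 𝕜) (x : State 𝕜 M) (n : ℤ) :
    constantCoeff (residual β γ δ k x n) =
      β * NormedSpace.exp ((γ + δ) * constantCoeff (x.logU n)) -
      (k + (γ + δ) * NormedSpace.exp (γ * constantCoeff (x.logU n)) *
        constantCoeff (x.ab (n - 1) n)) := by
  rw [residual, localSeries_useries, State.g_pred]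
  simp [State.upow, constantCoeff_sexp, smul_eq_C_mul]

theorem determinesUW {β γ δ k : 𝕜} (hγδ : γ + δ ≠ 0) :
    DeterminesUW (M := M) β γ δ k (fun j => coeff j (useries M (γ + δ) k))
      (fun j => coeff j (wseries M γ (γ + δ) k)) := by
  intro a b ℓ h0 hd
  let d : ℤ → 𝕜 := fun n => (γ + δ) * (β * NormedSpace.exp ((γ + δ) * ℓ n) -
      γ * NormedSpace.exp (γ * ℓ n) * constantCoeff (a (n - 1) ⬝ᵥ b n))
  have hd0 : ∀ n, d n ≠ 0 := fun n => mul_ne_zero hγδ (hd n)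
  let Lf : (ℕ × ℤ → 𝕜) → ℤ → 𝕜⟦X⟧ := fun f n =>
    PowerSeries.mk fun i => if i = 0 then ℓ n else f (i, n)
  let st : (ℤ → 𝕜⟦X⟧) → State 𝕜 M := fun L => ⟨a, b, L, 0⟩
  have hLf0 : ∀ f n, constantCoeff (Lf f n) = ℓ n := fun f n => by
    rw [← coeff_zero_eq_constantCoeff_apply, coeff_mk, if_pos rfl]
  -- A Newton step: a fixed point has zero residual. The dependence of `Φ f p` on `f p` cancels,
  -- leaving only lower orders. The value at order 0 is a dummy, as `Lf` inserts `ℓ` there.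
  let Φ : (ℕ × ℤ → 𝕜) → ℕ × ℤ → 𝕜 := fun f p => if p.1 = 0 then 0 else
    f p - coeff p.1 (residual β γ δ k (st (Lf f)) p.2) / d p.2
  have hΦ : ∀ f f' p, (∀ q : ℕ × ℤ, q.1 < p.1 → f q = f' q) → Φ f p = Φ f' p := by
    rintro f f' ⟨m, n⟩ hff
    simp only [Φ]
    split_ifs with hm
    · rfl
    · have hL : ∀ n, (X : 𝕜⟦X⟧) ^ m ∣ (st (Lf f)).logU n - (st (Lf f')).logU n := fun n =>
        dvd_of_coeff_sub fun r hr => by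
          simp only [st, Lf, coeff_mk]
          rw [hff (r, n) hr]
      have h := coeff_residual_sub (β := β) (γ := γ) (δ := δ) (k := k) (x := st (Lf f))
        (x' := st (Lf f')) rfl rfl (Nat.one_le_iff_ne_zero.2 hm) hL n
      have e : coeff m ((st (Lf f)).logU n - (st (Lf f')).logU n) = f (m, n) - f' (m, n) := by
        simp only [st, Lf, map_sub, coeff_mk, if_neg hm]
      have e' : (st (Lf f')).logU n = Lf f' n := rfl
      have e'' : (st (Lf f')).ab (n - 1) n = a (n - 1) ⬝ᵥ b n := rfl
      rw [e, e', hLf0, e''] at h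
      have hdn := hd0 n
      have h' : coeff m (residual β γ δ k (st (Lf f)) n) -
          coeff m (residual β γ δ k (st (Lf f')) n) = d n * (f (m, n) - f' (m, n)) := h
      field_simp
      linear_combination -h'
  obtain ⟨f, hf⟩ := exists_fixedPoint_of_rank (fun p : ℕ × ℤ => p.1) Φ hΦ
  have hres : ∀ n, residual β γ δ k (st (Lf f)) n = 0 := by
    intro n
    ext m
    rcases m with _ | m
    · rw [coeff_zero_eq_constantCoeff_apply, constantCoeff_residual]
      change β * NormedSpace.exp ((γ + δ) * constantCoeff (Lf f n)) -
        (k + (γ + δ) * NormedSpace.exp (γ * constantCoeff (Lf f n)) *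
        constantCoeff (a (n - 1) ⬝ᵥ b n)) = _
      rw [hLf0, h0 n, sub_self, map_zero]
    · have h := congrFun hf (m + 1, n)
      simp only [Φ, if_neg (Nat.succ_ne_zero m), sub_eq_self, div_eq_zero_iff, hd0 n,
        or_false] at h
      rw [h, map_zero]
  refine ⟨(Lf f, fun n => localSeries γ (fun j => coeff j (wseries M γ (γ + δ) k)) (st (Lf f)) n),
    ⟨hLf0 f, fun n => ⟨?_, ?_⟩⟩, ?_⟩
  · exact (sub_eq_zero.1 (hres n)).trans (localSeries_congr rfl rfl rfl _ _)
  · exact localSeries_congr rfl rfl rfl _ _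
  · rintro ⟨L, w⟩ ⟨hL0, hon⟩
    have key : ∀ m n, (X : 𝕜⟦X⟧) ^ m ∣ L n - Lf f n := by
      intro m
      induction m with
      | zero => simp
      | succ m ih =>
        intro n
        rw [X_pow_dvd_iff]
        intro r hr
        rcases (Nat.lt_succ_iff.1 hr).lt_or_eq with h | rfl
        · exact X_pow_dvd_iff.1 (ih n) r h
        · rcases r with _ | r
          · rw [coeff_zero_eq_constantCoeff_apply, map_sub, hLf0, sub_eq_zero]
            exact hL0 n
          · have h := coeff_residual_sub (β := β) (γ := γ) (δ := δ) (k := k) (x := ⟨a, b, L, w⟩)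
              (x' := st (Lf f)) rfl rfl (by omega) ih n
            have e1 : residual β γ δ k ⟨a, b, L, w⟩ n = 0 := sub_eq_zero.2 (hon n).1
            have e' : (st (Lf f)).logU n = Lf f n := rfl
            rw [e1, hres, sub_self, e', hLf0] at h
            exact (mul_eq_zero.1 h.symm).resolve_left (hd0 n)
    have hL : L = Lf f := funext fun n =>
      sub_eq_zero.1 (eq_zero_of_forall_X_pow_dvd fun m => key m n)
    subst hL
    refine Prod.ext rfl (funext fun n => ?_)
    exact (hon n).2.trans (localSeries_congr rfl rfl rfl _ _)

end Determination

/-! ### Tangency and reduction -/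

/-- The same double induction as in `isTriSol_congr`, applied to the linear system for the defect.
-/
theorem flowDefect_dvd {R : Type*} [CommRing R] {κ k ν₁ ν₂ : R⟦X⟧} {g dg Y dY err : ℤ → ℤ → R⟦X⟧}
    {v q : ℤ → R⟦X⟧} (hκ : κ * k = 1) (hY : IsTriSol X κ g Y)
    (hdY : ∀ n m, dY n m = ∑ l ∈ Ioc n m,
      (κ * (dg (n - 1) l + X * dY (n - 1) (l + 1)) * Y l m + cmat X κ g Y n l * dY l m))
    (hv : ∀ n, v n = k + g (n - 1) n + X * Y (n - 1) (n + 1))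
    (hq : ∀ n, q n = X * Y n (n + 1))
    (hdg : ∀ n m, n + 2 ≤ m → dg n m = ν₁ * (v (n + 1) * g (n + 1) m - v m * g n (m - 1)) +
      ν₂ * (X * g (n - 1) m - X * g n (m + 1) + (q n - q m) * g n m) + err n m) {i : ℕ}
    (herr : ∀ n m, (X : R⟦X⟧) ^ i ∣ err n m) (n m : ℤ) :
    (X : R⟦X⟧) ^ i ∣ flowDefect X ν₁ ν₂ v q Y dY n m := by
  have hH := flowDefect_eq hκ hY hdY hv hq hdg
  suffices H : ∀ j ≤ i, ∀ d : ℕ, ∀ n m : ℤ, (m - n).toNat = d →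
      (X : R⟦X⟧) ^ j ∣ flowDefect X ν₁ ν₂ v q Y dY n m from H i le_rfl _ n m rfl
  intro j
  induction j with
  | zero => intros; simp
  | succ j ihj =>
    intro hj d
    induction d using Nat.strong_induction_on with
    | _ d ihd =>
      intro n m hd
      rw [hH n m]
      refine dvd_sum fun l hl => ?_
      obtain ⟨h1, h2⟩ := mem_Ioc.1 hl
      refine dvd_add ((ihd (m - l).toNat (by omega) l m rfl).mul_left _)
        ((Dvd.dvd.mul_left (dvd_add ((pow_dvd_pow _ hj).trans (herr _ _)) ?_) _).mul_right _)
      rw [pow_succ']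
      exact mul_dvd_mul_left _ (ihj (by omega) _ _ _ rfl)

theorem Ioc_succ_right {n m : ℤ} (h : n ≤ m) : Ioc n (m + 1) = insert (m + 1) (Ioc n m) := by
  ext; simp; omega

theorem Ioc_pred_left {n m : ℤ} (h : n ≤ m) : Ioc (n - 1) m = insert n (Ioc n m) := by
  ext; simp; omega

theorem sum_Ioc_sub_pred {T : Type*} [AddCommGroup T] (ρ : ℤ → T) {n m : ℤ} (h : n ≤ m) :
    ∑ i ∈ Ioc n m, (ρ i - ρ (i - 1)) = ρ m - ρ n := by
  induction m, h using Int.leInduction with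
  | base => simp
  | succ m hm ih => rw [Ioc_succ_right hm, sum_insert (by simp), ih, add_sub_cancel_right]; abel

section Flows

variable {𝕜 : Type*} [RCLike 𝕜] {M : ℕ} {β γ δ k μ ν : 𝕜} {x : ℝ → State 𝕜 M} {t : ℝ}

theorem State.upow_add (x : State 𝕜 M) (r s : 𝕜) (n : ℤ) :
    x.upow (r + s) n = x.upow r n * x.upow s n := by
  rw [State.upow, add_smul, sexp_add]; rfl

theorem State.g_self (γ c : 𝕜) (x : State 𝕜 M) (n : ℤ) : x.g γ c n n = C c * x.ab n n := by
  rw [State.g, Ioc_self, prod_empty, mul_one]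

theorem State.g_pred_left (γ c : 𝕜) (x : State 𝕜 M) {n m : ℤ} (h : n ≤ m) :
    x.g γ c (n - 1) m = C c * (x.upow γ n * ∏ i ∈ Ioc n m, x.upow γ i) * x.ab (n - 1) m := by
  rw [State.g, Ioc_pred_left h, prod_insert (by simp)]

theorem State.g_succ_right (γ c : 𝕜) (x : State 𝕜 M) {n m : ℤ} (h : n ≤ m) :
    x.g γ c n (m + 1) =
      C c * (x.upow γ (m + 1) * ∏ i ∈ Ioc n m, x.upow γ i) * x.ab n (m + 1) := by
  rw [State.g, Ioc_succ_right h, prod_insert (by simp)]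

/-- The time derivative of `a n * b m`. -/
noncomputable def abRate (β γ δ μ ν : 𝕜) (x : State 𝕜 M) (n m : ℤ) : 𝕜⟦X⟧ :=
  C (μ - ν * γ) * (X * x.upow γ n * x.ab (n - 1) m - X * x.upow γ (m + 1) * x.ab n (m + 1)) +
  C (μ + ν * δ) * (C β * x.upow δ (n + 1) * x.ab (n + 1) m - C β * x.upow δ m * x.ab n (m - 1)) +
  (C μ * (x.w n - x.w m) + C (ν * γ * δ) * (x.ab n n - x.ab m m)) * x.ab n m

/-- The time derivative of `log u n` is `logRate n - logRate (n - 1)`. -/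
noncomputable def logRate (γ δ μ ν : 𝕜) (x : State 𝕜 M) (n : ℤ) : 𝕜⟦X⟧ :=
  C μ * x.ab n n + C ν * (x.w n - C (γ - δ) * x.ab n n)

theorem hasSeriesDerivAt_ab (h : EvolvesAB β γ δ μ ν x t) (n m : ℤ) :
    HasSeriesDerivAt (fun s => (x s).ab n m) (abRate β γ δ μ ν (x t) n m) t := by
  have H := HasSeriesDerivAt.sum univ fun i _ => ((h n i).1).mul ((h m i).2)
  convert! H using 1
  have e : ∀ i, (μ • firstA β γ δ (x t) n i + ν • secondA β γ δ (x t) n i) * (x t).b m i +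
      (x t).a n i * (μ • firstB β γ δ (x t) m i + ν • secondB β γ δ (x t) m i) =
      (C (μ - ν * γ) * X * (x t).upow γ n) * ((x t).a (n - 1) i * (x t).b m i) +
      (-(C (μ - ν * γ) * X * (x t).upow γ (m + 1))) * ((x t).a n i * (x t).b (m + 1) i) +
      (C (μ + ν * δ) * (C β * (x t).upow δ (n + 1))) * ((x t).a (n + 1) i * (x t).b m i) +
      (-(C (μ + ν * δ) * (C β * (x t).upow δ m))) * ((x t).a n i * (x t).b (m - 1) i) +
      (C μ * ((x t).w n - (x t).w m) + C (ν * γ * δ) * ((x t).ab n n - (x t).ab m m)) *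
        ((x t).a n i * (x t).b m i) := by
    intro i
    simp only [firstA, firstB, secondA, secondB, Pi.add_apply, Pi.neg_apply, Pi.smul_apply,
      Pi.sub_apply, smul_eq_mul, smul_eq_C_mul, map_sub, map_add, map_mul]
    ring
  simp only [e, sum_add_distrib, ← mul_sum]
  simp only [abRate, State.ab, dotProduct]
  ring

theorem hasSeriesDerivAt_upow {σ : ℤ → 𝕜⟦X⟧}
    (hσ : ∀ n, HasSeriesDerivAt (fun s => (x s).logU n) (σ n) t) (r : 𝕜) (n : ℤ) :
    HasSeriesDerivAt (fun s => (x s).upow r n) ((x t).upow r n * (C r * σ n)) t := by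
  have h := ((hσ n).const_mul (C r)).sexp
  simpa only [State.upow, smul_eq_C_mul] using h

theorem hasSeriesDerivAt_g {σ : ℤ → 𝕜⟦X⟧}
    (hσ : ∀ n, HasSeriesDerivAt (fun s => (x s).logU n) (σ n) t)
    (h : EvolvesAB β γ δ μ ν x t) (c : 𝕜) (n m : ℤ) :
    HasSeriesDerivAt (fun s => (x s).g γ c n m)
      (C c * (∏ i ∈ Ioc n m, (x t).upow γ i) *
        ((∑ i ∈ Ioc n m, C γ * σ i) * (x t).ab n m + abRate β γ δ μ ν (x t) n m)) t := by
  have H := ((HasSeriesDerivAt.prod_of_log (Ioc n m) fun i _ =>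
    hasSeriesDerivAt_upow hσ γ i).const_mul (C c)).mul (hasSeriesDerivAt_ab h n m)
  convert! H using 1
  ring

/-- The rates of the `log u i` telescope. Their contribution at the two ends combines with the
diagonal terms of `abRate` into `(μ - ν γ) (q n - q m)`, because `w - γ a b = q`; the factors `u ^
γ` and `β u ^ δ` at an end combine into `v`. -/
theorem gRate_eq {σ ε : ℤ → 𝕜⟦X⟧} {x : State 𝕜 M}
    (hε : ∀ n, σ n = logRate γ δ μ ν x n - logRate γ δ μ ν x (n - 1) + ε n) {v q : ℤ → 𝕜⟦X⟧}
    (hv : ∀ n, v n = C β * x.upow (γ + δ) n) (hq : ∀ n, x.w n = C γ * x.ab n n + q n)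
    {n m : ℤ} (hnm : n < m) :
    C (γ + δ) * (∏ i ∈ Ioc n m, x.upow γ i) *
        ((∑ i ∈ Ioc n m, C γ * σ i) * x.ab n m + abRate β γ δ μ ν x n m) =
      C (μ + ν * δ) * (v (n + 1) * x.g γ (γ + δ) (n + 1) m - v m * x.g γ (γ + δ) n (m - 1)) +
      C (μ - ν * γ) * (X * x.g γ (γ + δ) (n - 1) m - X * x.g γ (γ + δ) n (m + 1) +
        (q n - q m) * x.g γ (γ + δ) n m) +
      C γ * (∑ i ∈ Ioc n m, ε i) * x.g γ (γ + δ) n m := by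
  have hs : ∑ i ∈ Ioc n m, C γ * σ i =
      C γ * (logRate γ δ μ ν x m - logRate γ δ μ ν x n + ∑ i ∈ Ioc n m, ε i) := by
    rw [← mul_sum, sum_congr rfl fun i _ => hε i, sum_add_distrib, sum_Ioc_sub_pred _ hnm.le]
  have e1 : ∏ i ∈ Ioc n m, x.upow γ i = x.upow γ (n + 1) * ∏ i ∈ Ioc (n + 1) m, x.upow γ i := by
    have := Ioc_pred_left (show n + 1 ≤ m by omega)
    rw [add_sub_cancel_right] at this
    rw [this, prod_insert (by simp)]
  have e2 : ∏ i ∈ Ioc n m, x.upow γ i = x.upow γ m * ∏ i ∈ Ioc n (m - 1), x.upow γ i := by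
    have := Ioc_succ_right (show n ≤ m - 1 by omega)
    rw [sub_add_cancel] at this
    rw [this, prod_insert (by simp)]
  rw [hs, State.g_pred_left _ _ _ hnm.le, State.g_succ_right _ _ _ hnm.le, State.g, State.g,
    State.g, hv, hv, State.upow_add, State.upow_add, abRate, logRate, logRate, hq n, hq m]
  simp only [map_add, map_sub, map_mul]
  set Q := ∏ i ∈ Ioc n m, x.upow γ i
  linear_combination (C γ + C δ) * (C μ + C ν * C δ) *
    (C β * x.upow δ (n + 1) * x.ab (n + 1) m) * e1 -
    (C γ + C δ) * (C μ + C ν * C δ) * (C β * x.upow δ m * x.ab n (m - 1)) * e2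

/-- The rates of change of the two sides of the constraints, in terms of the deviation `ε` of the
rates of change of the `log u n` from those prescribed by the flow. -/
theorem exists_defect (hk : k ≠ 0) {σ ε : ℤ → 𝕜⟦X⟧}
    (hσ : ∀ n, HasSeriesDerivAt (fun s => (x s).logU n) (σ n) t)
    (h : EvolvesAB β γ δ μ ν x t)
    (hon : OnReduction β γ δ (fun j => coeff j (useries M (γ + δ) k))
      (fun j => coeff j (wseries M γ (γ + δ) k)) (x t))
    (hε : ∀ n, σ n = logRate γ δ μ ν (x t) n - logRate γ δ μ ν (x t) (n - 1) + ε n) :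
    ∃ H : ℤ → ℤ → 𝕜⟦X⟧,
      (∀ i : ℕ, (∀ n, (X : 𝕜⟦X⟧) ^ i ∣ ε n) → ∀ n m, (X : 𝕜⟦X⟧) ^ i ∣ H n m) ∧
      ∀ n, HasSeriesDerivAt (fun s => residual β γ δ k (x s) n)
        (C (γ + δ) * (C β * (x t).upow (γ + δ) n - C γ * (x t).upow γ n * (x t).ab (n - 1) n) *
          ε n - X * H (n - 1) (n + 1)) t ∧
        HasSeriesDerivAt
          (fun s => localSeries γ (fun j => coeff j (wseries M γ (γ + δ) k)) (x s) n)
          (μ • firstW β γ δ (x t) n + ν • secondW β γ δ (x t) n + X * H n (n + 1)) t := by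
  set c := γ + δ with hc
  obtain ⟨v, hvu⟩ : ∃ v : ℤ → 𝕜⟦X⟧, ∀ n, v n = C β * (x t).upow c n := ⟨_, fun _ => rfl⟩
  obtain ⟨q, hqy⟩ : ∃ q : ℤ → 𝕜⟦X⟧, ∀ n, q n = X * (x t).y γ c k⁻¹ n (n + 1) := ⟨_, fun _ => rfl⟩
  have hv : ∀ n, v n = C k + (x t).g γ c (n - 1) n + X * (x t).y γ c k⁻¹ (n - 1) (n + 1) :=
    fun n => (hvu n).trans ((hon n).1.trans (localSeries_useries γ c k (x t) n))
  have hq : ∀ n, (x t).w n = C γ * (x t).ab n n + q n :=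
    fun n => by rw [hqy]; exact (hon n).2.trans (localSeries_wseries γ c k (x t) n)
  have hκ : (C k⁻¹ : 𝕜⟦X⟧) * C k = 1 := by rw [← map_mul, inv_mul_cancel₀ hk, map_one]
  have hY := fun s => (x s).y_isTriSol γ c k⁻¹
  obtain ⟨dg, hdge⟩ : ∃ dg : ℤ → ℤ → 𝕜⟦X⟧, ∀ n m, dg n m =
      C c * (∏ i ∈ Ioc n m, (x t).upow γ i) *
        ((∑ i ∈ Ioc n m, C γ * σ i) * (x t).ab n m + abRate β γ δ μ ν (x t) n m) :=
    ⟨_, fun _ _ => rfl⟩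
  have hg : ∀ n m, HasSeriesDerivAt (fun s => (x s).g γ c n m) (dg n m) t := fun n m => by
    rw [hdge]; exact hasSeriesDerivAt_g hσ h c n m
  let err : ℤ → ℤ → 𝕜⟦X⟧ := fun n m => C γ * (∑ i ∈ Ioc n m, ε i) * (x t).g γ c n m
  have hdg : ∀ n m, n < m → dg n m =
      C (μ + ν * δ) * (v (n + 1) * (x t).g γ c (n + 1) m - v m * (x t).g γ c n (m - 1)) +
      C (μ - ν * γ) * (X * (x t).g γ c (n - 1) m - X * (x t).g γ c n (m + 1) +
        (q n - q m) * (x t).g γ c n m) + err n m :=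
    fun n m hnm => by rw [hdge]; exact gRate_eq hε hvu hq hnm
  -- Only existence of the derivatives is needed, and it holds since each coefficient is polynomial
  -- in differentiable variables; the relation among them comes from differentiating the triangular
  -- system.
  have hydiff : ∀ n m, ∃ d, HasSeriesDerivAt (fun s => (x s).y γ c k⁻¹ n m) d t := by
    intro n m
    have hV : ∀ V, SeriesDifferentiableAt (fun s => Var.eval γ (x s) 0 V) t := by
      intro V
      cases V with
      | a j i => exact (h _ i).1.seriesDifferentiableAt
      | b j i => exact (h _ i).2.seriesDifferentiableAt
      | p j => exact (hasSeriesDerivAt_upow hσ γ _).seriesDifferentiableAt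
    refine SeriesDifferentiableAt.exists_hasSeriesDerivAt fun r => ?_
    have e : ∀ s, coeff r ((x s).y γ c k⁻¹ n m) = ∑ j ∈ range (r + 1), coeff (r - j)
        (MvPolynomial.aeval (Var.eval γ (x s) 0) (coeff j (ypoly M c k⁻¹ n m))) :=
      fun s => by
        change coeff r (expand _ _) = _
        rw [expand, coeff_mk]
        rfl
    simp only [e]
    exact DifferentiableAt.fun_sum fun j _ => seriesDifferentiableAt_aeval hV _ _
  choose dy hdy using hydiff
  have hdY : ∀ n m, dy n m = ∑ l ∈ Ioc n m,
      (C k⁻¹ * (dg (n - 1) l + X * dy (n - 1) (l + 1)) * (x t).y γ c k⁻¹ l m +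
        cmat X (C k⁻¹) ((x t).g γ c) ((x t).y γ c k⁻¹) n l * dy l m) := by
    intro n m
    have H := HasSeriesDerivAt.sum (Ioc n m) fun l _ =>
      (((hg (n - 1) l).add ((hdy (n - 1) (l + 1)).const_mul X)).const_mul (C k⁻¹)).mul (hdy l m)
    have H' := (HasSeriesDerivAt.const (if n = m then 1 else 0) t).add H
    have e : (fun s => (x s).y γ c k⁻¹ n m) = fun s => (if n = m then 1 else 0) +
        ∑ l ∈ Ioc n m, C k⁻¹ * ((x s).g γ c (n - 1) l + X * (x s).y γ c k⁻¹ (n - 1) (l + 1)) *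
          (x s).y γ c k⁻¹ l m := by
      funext s
      rw [hY s n m]
      congr 1
      exact sum_congr rfl fun l hl => by rw [cmat_of_lt (mem_Ioc.1 hl).1]
    have h1 := hdy n m
    rw [e] at h1
    rw [h1.unique H', zero_add]
    exact sum_congr rfl fun l hl => by rw [cmat_of_lt (mem_Ioc.1 hl).1]
  have hcC : (C c : 𝕜⟦X⟧) = C γ + C δ := map_add _ _ _
  -- The entry next to the diagonal of the triangular system, times `k X`; it eliminates the
  -- products `k q` that arise from `v = k + ⋯`.
  have hkq : ∀ n, C k * q n =
      X * ((x t).g γ c (n - 1) (n + 1) + X * (x t).y γ c k⁻¹ (n - 1) (n + 1 + 1)) := fun n => by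
    rw [hqy, (hY t).succ, cmat_of_lt (by omega)]
    linear_combination X * ((x t).g γ c (n - 1) (n + 1) +
      X * (x t).y γ c k⁻¹ (n - 1) (n + 1 + 1)) * hκ
  refine ⟨flowDefect X (C (μ + ν * δ)) (C (μ - ν * γ)) v q ((x t).y γ c k⁻¹) dy,
    fun i hi n m => flowDefect_dvd hκ (hY t) hdY hv hqy
      (fun n m hnm => hdg n m (by omega))
      (fun n m => ((dvd_sum fun l _ => hi l).mul_left _).mul_right _) n m, fun n => ⟨?_, ?_⟩⟩
  · have H := ((hasSeriesDerivAt_upow hσ c n).const_mul (C β)).sub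
      (((HasSeriesDerivAt.const (C k) t).add (hg (n - 1) n)).add
        ((hdy (n - 1) (n + 1)).const_mul X))
    simp only [residual, ← hc, localSeries_useries]
    convert! H using 1
    have hkq' := hkq (n - 1)
    have hdg' := hdg (n - 1) n (by omega)
    have hqy' := hqy (n - 1)
    have hIoc : Ioc (n - 1) n = {n} := by ext; simp; omega
    simp only [err, hIoc, sum_singleton, sub_add_cancel] at hdg'
    rw [State.g_self, State.g_self] at hdg'
    simp only [sub_add_cancel] at hkq' hqy'
    have hG := (x t).g_pred γ c n
    rw [hε, logRate, logRate, hq, hq, ← mul_assoc (C β), ← hvu]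
    simp only [flowDefect, sub_add_cancel, add_sub_cancel_right]
    have hvn := hv n
    simp only [hcC, map_add, map_sub, map_mul] at hdg' hG hkq' hvn ⊢
    linear_combination hdg' - (C μ - C ν * C γ) * (hkq' - hkq n) -
      (C μ - C ν * C γ) * (q (n - 1) - q n) * hvn + C γ * ε n * hG -
      (C μ + C ν * C δ) * v n * (hqy n - hqy')
  · have H := ((hasSeriesDerivAt_ab h n n).const_mul (C γ)).add ((hdy n (n + 1)).const_mul X)
    simp only [localSeries_wseries]
    convert! H using 1
    have hv' := hv (n + 1)
    have hG := (x t).g_pred γ c n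
    have hG' := (x t).g_pred γ c (n + 1)
    simp only [add_sub_cancel_right] at hv' hG'
    simp only [flowDefect, firstW, secondW, abRate, (hY t).diag, sub_self, smul_eq_C_mul,
      add_sub_cancel_right, ← hc]
    have hvn := hv n
    have hu := hvu n
    have hu' := hvu (n + 1)
    simp only [hcC, map_add, map_sub, map_mul] at hv' hG hG' hvn ⊢
    linear_combination -(C μ - C ν * C γ) * X * (hv' - hvn + hG' - hG) -
      C ν * X * (C γ + C δ) * (hu' - hu)

end Flows

section Main

variable {𝕜 : Type*} [RCLike 𝕜] {M : ℕ} {β γ δ k : 𝕜}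

theorem firstU_add_secondU (μ ν : 𝕜) (x : State 𝕜 M) (n : ℤ) :
    μ • firstU x n + ν • secondU γ δ x n =
      x.u n * (logRate γ δ μ ν x n - logRate γ δ μ ν x (n - 1)) := by
  simp only [firstU, secondU, logRate, smul_eq_C_mul]
  ring

theorem isInvariant (hk : k ≠ 0) (μ ν : 𝕜) :
    IsInvariant (M := M) β γ δ (fun j => coeff j (useries M (γ + δ) k))
      (fun j => coeff j (wseries M γ (γ + δ) k)) μ ν := by
  intro x t hon hdiff hab huw n
  choose σ hσ using fun n => (hdiff n).exists_hasSeriesDerivAt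
  have hε : ∀ n, σ n = logRate γ δ μ ν (x t) n - logRate γ δ μ ν (x t) (n - 1) + 0 := by
    intro n
    -- The derivative of `log u n` is read off from that of `u n` by cancelling the unit `u n`.
    have h := (hσ n).sexp.unique (huw n).1
    rw [firstU_add_secondU] at h
    rw [add_zero]
    exact (isUnit_sexp ((x t).logU n)).mul_left_cancel h
  obtain ⟨H, hH, hd⟩ := exists_defect (ε := fun _ => 0) hk hσ hab hon hε
  have hH0 : ∀ n m, H n m = 0 := fun n m =>
    eq_zero_of_forall_X_pow_dvd fun i => hH i (fun _ => dvd_zero _) n m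
  obtain ⟨h1, h2⟩ := hd n
  rw [hH0, mul_zero, mul_zero, sub_zero] at h1
  rw [hH0, mul_zero, add_zero] at h2
  have h3 := (huw n).2.sub h2
  rw [sub_self] at h3
  exact ⟨h1, h3⟩

theorem reduces (hγδ : γ + δ ≠ 0) (hk : k ≠ 0) (μ ν : 𝕜) :
    Reduces (M := M) β γ δ (fun j => coeff j (useries M (γ + δ) k))
      (fun j => coeff j (wseries M γ (γ + δ) k)) μ ν := by
  intro I x hI hon hnd hdiff hab t ht n
  have hIt : ∀ᶠ s in nhds t, s ∈ I := hI.mem_nhds ht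
  choose σ hσ using fun n => (hdiff t ht n).exists_hasSeriesDerivAt
  obtain ⟨ε, hεdef⟩ : ∃ ε : ℤ → 𝕜⟦X⟧, ∀ n, ε n =
      σ n - (logRate γ δ μ ν (x t) n - logRate γ δ μ ν (x t) (n - 1)) := ⟨_, fun _ => rfl⟩
  have hε : ∀ n, σ n = logRate γ δ μ ν (x t) n - logRate γ δ μ ν (x t) (n - 1) + ε n :=
    fun n => by rw [hεdef]; ring
  obtain ⟨H, hH, hd⟩ := exists_defect hk hσ (hab t ht) (hon t ht) hε
  have hrel : ∀ n, C (γ + δ) * (C β * (x t).upow (γ + δ) n -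
      -- The residual is zero on a neighbourhood of `t`, so its derivative is zero; openness of `I`
      -- enters here.
      C γ * (x t).upow γ n * (x t).ab (n - 1) n) * ε n = X * H (n - 1) (n + 1) := fun n =>
    sub_eq_zero.1 <| (hd n).1.unique <| (HasSeriesDerivAt.const 0 t).congr_of_eventuallyEq <|
      hIt.mono fun s hs => sub_eq_zero.2 (hon s hs n).1
  -- Bootstrap: if `X ^ i` divides all `ε`, it divides the defect, and the extra `X` in `hrel` gives
  -- `X ^ (i + 1)` after cancelling a factor that is a unit by nondegeneracy.
  have hdvd : ∀ i : ℕ, ∀ n, (X : 𝕜⟦X⟧) ^ i ∣ ε n := by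
    intro i
    induction i with
    | zero => simp
    | succ i ih =>
      intro n
      have hu : IsUnit (C (γ + δ) * (C β * (x t).upow (γ + δ) n -
          C γ * (x t).upow γ n * (x t).ab (n - 1) n)) := by
        rw [isUnit_iff_constantCoeff, map_mul, constantCoeff_C, isUnit_iff_ne_zero]
        exact mul_ne_zero hγδ (hnd t ht n)
      rw [← hu.dvd_mul_left, hrel, pow_succ']
      exact mul_dvd_mul_left _ (hH i ih _ _)
  have hε0 : ∀ n, ε n = 0 := fun n => eq_zero_of_forall_X_pow_dvd fun i => hdvd i n
  have hH0 : ∀ n m, H n m = 0 := fun n m =>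
    eq_zero_of_forall_X_pow_dvd fun i => hH i (hdvd i) n m
  refine ⟨?_, ?_⟩
  · rw [firstU_add_secondU]
    have h := (hσ n).sexp
    rw [hε, hε0, add_zero] at h
    exact h
  · have h := (hd n).2
    rw [hH0, mul_zero, add_zero] at h
    exact h.congr_of_eventuallyEq (hIt.mono fun s hs => (hon s hs n).2)

end Main

end GenToda

open GenToda GenToda.LocalPoly in
theorem mainTheorem2 {𝕜 : Type*} [RCLike 𝕜] (M : ℕ) (β γ δ k : 𝕜)
    (hγδ : γ + δ ≠ 0) (hk : k ≠ 0) :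
    ∃ U W : ℕ → LocalPoly 𝕜 M,
      -- the displayed low-order coefficients
      U 0 = MvPolynomial.C k + MvPolynomial.C (γ + δ) * p 0 * (av (-1) ⬝ᵥ bv 0) ∧
      U 1 = MvPolynomial.C ((γ + δ) / k) * (p (-1) * p 0 * p 1) *
        (av (-2) ⬝ᵥ Matrix.mulVec (mat ((γ + δ) / k) 0) (bv 1)) ∧
      W 0 = MvPolynomial.C γ * (av 0 ⬝ᵥ bv 0) ∧
      W 1 = MvPolynomial.C ((γ + δ) / k) * (p 0 * p 1) * (av (-1) ⬝ᵥ bv 1) ∧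
      W 2 = MvPolynomial.C ((γ + δ) / k ^ 2) * (p (-1) * p 0 * p 1 * p 2) *
        (av (-2) ⬝ᵥ Matrix.mulVec
          (mat ((γ + δ) / k) 0 * mat ((γ + δ) / k) 1) (bv 2)) ∧
      -- the constraints determine `u` and `w` implicitly
      DeterminesUW β γ δ k U W ∧
      -- the same constraints reduce every linear combination of the two flows
      ∀ μ ν : 𝕜, IsInvariant β γ δ U W μ ν ∧ Reduces β γ δ U W μ ν :=
  ⟨fun j => PowerSeries.coeff j (useries M (γ + δ) k),
    fun j => PowerSeries.coeff j (wseries M γ (γ + δ) k),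
    coeff_zero_useries _ _, coeff_one_useries _ _, coeff_zero_wseries _ _ _,
    coeff_one_wseries _ _ _, coeff_two_wseries _ _ _, determinesUW hγδ,
    fun μ ν => ⟨isInvariant hk μ ν, reduces hγδ hk μ ν⟩⟩
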